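/- Let $(\Omega,\mathcal F,\mathcal P)$ be a probability space carrying a Cram\'er--Lundberg free surplus process $$X_t=x+pt-\sum_{i=1}^{N_t}U_i,\qquad t\ge 0,$$ where $x\ge 0$ is the initial surplus, $p$ is the premium rate, $N$ is a Poisson process with intensity $\beta>0$, and the claim sizes $U_i\ge 0$ are i.i.d., integrable and independent of $N$, with distribution function $F$. Assume the safety loading condition $p>\beta\,\mathbb E[U_1]$ and that $F$ is globally Lipschitz: there is $K\geq 0$ with $|F(y)-F(z)|\le K|y-z|$ for all $y,z\in\mathbb R$. Let $\mathcal F_t$ be the $\sigma$-algebra generated by $(X_s)_{0\le s\le t}$ and the events of probability zero, and let $q>0$ be a discount rate. Let $\overline c>0$ be the maximal dividend rate. For $x\ge 0$ and $c\in[0,\overline c]$ let $\Pi_{x,c,\overline c}$ be the set of processes $C=(C_t)_{t\ge 0}$ that are c\`adl\`ag, adapted to $(\mathcal F_t)_{t\ge 0}$, non-decreasing in $t$, and satisfy $c\le C_t\le\overline c$ for all $t\geq 0$. For such $C$ put $$X^C_t=X_t-\int_0^t C_s\,ds,\qquad \tau=\inf\{t\ge 0: X^C_t<0\}\in[0,\infty],\qquad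 J(x;C)=\mathbb E\Big[\int_0^{\tau}e^{-qs}C_s\,ds\Big],$$ and define $V(x,c)=\sup_{C\in\Pi_{x,c,\overline c}}J(x;C)$ on $[0,\infty)\times[0,\overline c]$. Assume $\overline c>p$. Then: 1. for every $x>0$, $\lim_{c\to p^+}V(x,c)=V(x,p)$; 2. $V$, as a function of the pair $(x,c)\in[0,\infty)\times[0,\overline c]$, is continuous at every point other than $(0,p)$; 3. $V$ is not continuous at $(0,p)$: $V(0,p)=\dfrac{p}{q+\beta}>0$, whereas $V(0,c)=0$ for all $c\in(p,\overline c]$, so that $\lim_{c\to p^+}V(0,c)=0<V(0,p)$. -/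

import Mathlib

open MeasureTheory ProbabilityTheory Set Filter Topology
open scoped NNReal

noncomputable section

namespace DividendRatcheting

/-- The random data of the Cramér–Lundberg model. `W i` is the waiting time before claim number
`i + 1` (so that claims arrive as a Poisson process of intensity `β`) and `U i` is the size of that
claim. The claim sizes are i.i.d. and nonnegative; claim sizes and claim arrivals are
independent. -/
structure IsCramerLundberg {Ω : Type*} [MeasurableSpace Ω] (μ : Measure Ω) (β : ℝ) (W U : ℕ → Ω → ℝ) : Prop where
  measurable_wait : ∀ i, Measurable (W i)
  measurable_claim : ∀ i, Measurable (U i)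
  law_wait : ∀ i, μ.map (W i) = expMeasure β
  law_claim : ∀ i, μ.map (U i) = μ.map (U 0)
  claim_nonneg : ∀ i, ∀ᵐ ω ∂μ, 0 ≤ U i ω
  indep : iIndepFun (Sum.elim W U) μ

/-- The distribution function `F` of the claim sizes. -/
def claimCDF {Ω : Type*} [MeasurableSpace Ω] (μ : Measure Ω) (U : ℕ → Ω → ℝ) : ℝ → ℝ :=
  fun y => cdf (μ.map (U 0)) y

/-- Arrival time of claim number `n + 1`. -/
def arrivalTime {Ω : Type*} (W : ℕ → Ω → ℝ) (n : ℕ) (ω : Ω) : ℝ :=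
  ∑ i ∈ Finset.range (n + 1), W i ω

/-- The Poisson process `N_t`: the number of claims up to time `t`. -/
def claimCount {Ω : Type*} (W : ℕ → Ω → ℝ) (t : ℝ) (ω : Ω) : ℕ :=
  {n : ℕ | arrivalTime W n ω ≤ t}.ncard

/-- The free surplus `X_t = x + p t - ∑_{i ≤ N_t} U_i`. -/
def freeSurplus {Ω : Type*} (p : ℝ) (W U : ℕ → Ω → ℝ) (x t : ℝ) (ω : Ω) : ℝ :=
  x + p * t - ∑ i ∈ Finset.range (claimCount W t ω), U i ω

/-- The σ-algebra `ℱ_t` generated by `X_s`, `0 ≤ s ≤ t`, and the events of probability zero. -/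
@[reducible] def surplusSigma {Ω : Type*} [MeasurableSpace Ω] (μ : Measure Ω) (p : ℝ)
    (W U : ℕ → Ω → ℝ) (x t : ℝ) : MeasurableSpace Ω :=
  (⨆ s ∈ Icc (0 : ℝ) t, MeasurableSpace.comap (freeSurplus p W U x s) inferInstance) ⊔
    MeasurableSpace.generateFrom {A : Set Ω | MeasurableSet A ∧ μ A = 0}

/-- The admissible dividend ratcheting strategies `Π_{x,c,c̄}`. Only the values `C t` with `0 ≤ t`
matter. -/
structure IsAdmissible {Ω : Type*} [MeasurableSpace Ω] (μ : Measure Ω)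
    (p cbar : ℝ) (W U : ℕ → Ω → ℝ) (x c : ℝ)
    (C : ℝ → Ω → ℝ) : Prop where
  adapted : ∀ t, 0 ≤ t → Measurable[surplusSigma μ p W U x t] (C t)
  right_cont : ∀ ω t, 0 ≤ t → ContinuousWithinAt (fun s => C s ω) (Ici t) t
  left_lim : ∀ ω t, 0 < t → ∃ l : ℝ, Tendsto (fun s => C s ω) (𝓝[<] t) (𝓝 l)
  mono : ∀ ω, MonotoneOn (fun s => C s ω) (Ici 0)
  mem_Icc : ∀ ω t, 0 ≤ t → C t ω ∈ Icc c cbar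

/-- The controlled surplus `X_t^C = X_t - ∫_0^t C_s ds`. -/
def controlledSurplus {Ω : Type*} (p : ℝ) (W U : ℕ → Ω → ℝ) (x : ℝ) (C : ℝ → Ω → ℝ)
    (t : ℝ) (ω : Ω) : ℝ :=
  freeSurplus p W U x t ω - ∫ s in (0 : ℝ)..t, C s ω

/-- The ruin time `inf {t ≥ 0 : X_t^C < 0}`, equal to `⊤` when there is no ruin. -/
def ruinTime {Ω : Type*} (p : ℝ) (W U : ℕ → Ω → ℝ) (x : ℝ) (C : ℝ → Ω → ℝ)
    (ω : Ω) : EReal :=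
  ⨅ t ∈ {t : ℝ | 0 ≤ t ∧ controlledSurplus p W U x C t ω < 0}, (t : EReal)

/-- The value `J(x;C) = 𝔼[∫_0^τ e^{-qs} C_s ds]` of a strategy. -/
def strategyValue {Ω : Type*} [MeasurableSpace Ω] (μ : Measure Ω)
    (p q : ℝ) (W U : ℕ → Ω → ℝ) (x : ℝ) (C : ℝ → Ω → ℝ) : ℝ :=
  ∫ ω, (∫ s in {s : ℝ | 0 ≤ s ∧ (s : EReal) < ruinTime p W U x C ω},
    Real.exp (-q * s) * C s ω) ∂μ

/-- The optimal value function `V(x,c)`, the supremum of `J(x;C)` over `C ∈ Π_{x,c,c̄}`. -/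
def valueFunction {Ω : Type*} [MeasurableSpace Ω] (μ : Measure Ω)
    (p q cbar : ℝ) (W U : ℕ → Ω → ℝ) (x c : ℝ) : ℝ :=
  sSup (strategyValue μ p q W U x '' {C | IsAdmissible μ p cbar W U x c C})

/-- The domain `[0,∞) × [0,c̄]` of the value function. -/
def valueDomain (cbar : ℝ) : Set (ℝ × ℝ) := Ici 0 ×ˢ Icc 0 cbar

end DividendRatcheting

end

namespace DividendRatcheting

/-! Continuity comes from a comparison of strategies. A strategy `C` started at `(x', c')` is copied
at a nearby point `(x, c)` by its shadow `D`, which raises `C` to at least `c` and lowers rates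
below `p + ε` to at most `max p c`. The shadow loses at most `ε` in rate, and up to a horizon `M`
its surplus is at most `δ` below that of `C`. Only the event that `D` is ruined well before `C`
could be costly.

Suppose the surplus of `D` is negative at time `t`. If the rate of `D` is at least `p + ε`,
ratcheting keeps it there, the surplus falls at speed at least `ε`, and `C` is ruined within a
further `δ / ε`. If the rate is at most `p + η`, the surplus can hardly have fallen between claims,
so some claim left it within `δ` of zero. The size of claim `k` is independent of the surplus just
before it, because the strategy then knows only earlier claims and arrival times; with `F`
Lipschitz, such a landing has probability at most `2Kδ`. This is `IsShadow.exists_nearRuinClaim`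
together with `measure_claim_mem_Ioc_le`. Discounting removes times after `M` and after the `n`-th
arrival, and `valueFunction_le_add` collects the errors.

The argument needs each rate of `D` to be at most `p + η` or at least `p + ε`, with `η * M ≤ x`.
Near `c = p` this forces `η > 0`, hence `x > 0`, so exactly `(0, p)` is lost. There continuity
really fails: from zero surplus the rate `p` keeps the surplus at zero until the first claim, while
any rate above `p` ruins at once. -/

/-- The regular outcomes: positive waiting times, nonnegative claims, and finitely many claims in
every bounded time interval. -/
structure IsRegularPath {Ω : Type*} (W U : ℕ → Ω → ℝ) (ω : Ω) : Prop where
  wait_pos : ∀ i, 0 < W i ω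
  claim_nonneg : ∀ i, 0 ≤ U i ω
  tendsto_arrival : Tendsto (fun n => arrivalTime W n ω) atTop atTop

/-! ### Claim counts and free surplus along a regular path -/

section Path

variable {Ω : Type*} {W U : ℕ → Ω → ℝ} {ω : Ω} {p x : ℝ}

lemma arrivalTime_succ (n : ℕ) : arrivalTime W (n + 1) ω = arrivalTime W n ω + W (n + 1) ω := by
  simp [arrivalTime, Finset.sum_range_succ]

namespace IsRegularPath

lemma strictMono_arrivalTime (h : IsRegularPath W U ω) :
    StrictMono fun n => arrivalTime W n ω :=
  strictMono_nat_of_lt_succ fun n => by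
    rw [arrivalTime_succ]
    linarith [h.wait_pos (n + 1)]

lemma arrivalTime_pos (h : IsRegularPath W U ω) (n : ℕ) : 0 < arrivalTime W n ω :=
  Finset.sum_pos (fun i _ => h.wait_pos i) (by simp)

/-- Arrival times increase to infinity, so the indices of claims up to `t` form a finite initial
segment and `ncard` is a genuine count. -/
lemma lt_claimCount_iff (h : IsRegularPath W U ω) {t : ℝ} {n : ℕ} :
    n < claimCount W t ω ↔ arrivalTime W n ω ≤ t := by
  classical
  have hex : ∃ n, t < arrivalTime W n ω := (h.tendsto_arrival.eventually_gt_atTop t).exists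
  have hset : {n : ℕ | arrivalTime W n ω ≤ t} = Finset.range (Nat.find hex) := by
    ext m
    simp only [mem_ofPred_eq, Finset.coe_range, mem_Iio, Nat.lt_find_iff, not_lt]
    exact ⟨fun hm j hj => (h.strictMono_arrivalTime.monotone hj).trans hm, fun hm => hm m le_rfl⟩
  have hcount : claimCount W t ω = Nat.find hex := by
    rw [claimCount, hset, ncard_coe_finset, Finset.card_range]
  rw [hcount]
  have := congrArg (n ∈ ·) hset
  simpa using this.symm

lemma claimCount_le_iff (h : IsRegularPath W U ω) {t : ℝ} {n : ℕ} :
    claimCount W t ω ≤ n ↔ t < arrivalTime W n ω := by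
  rw [← not_lt, h.lt_claimCount_iff, not_le]

lemma claimCount_mono (h : IsRegularPath W U ω) : Monotone fun t => claimCount W t ω :=
  fun _ _ hst => h.claimCount_le_iff.2 (hst.trans_lt (h.claimCount_le_iff.1 le_rfl))

lemma claimCount_arrivalTime (h : IsRegularPath W U ω) (n : ℕ) :
    claimCount W (arrivalTime W n ω) ω = n + 1 :=
  le_antisymm (h.claimCount_le_iff.2 (h.strictMono_arrivalTime n.lt_succ_self))
    (h.lt_claimCount_iff.2 le_rfl)

lemma freeSurplus_le (h : IsRegularPath W U ω) {s t : ℝ} (hst : s ≤ t) :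
    freeSurplus p W U x t ω ≤ freeSurplus p W U x s ω + p * (t - s) := by
  have := Finset.sum_le_sum_of_subset_of_nonneg
    (Finset.range_subset_range.2 (h.claimCount_mono hst)) fun i _ _ => h.claim_nonneg i
  simp only [freeSurplus]
  linarith

lemma freeSurplus_arrivalTime (h : IsRegularPath W U ω) (n : ℕ) :
    freeSurplus p W U x (arrivalTime W n ω) ω =
      x + p * arrivalTime W n ω - ∑ i ∈ Finset.range n, U i ω - U n ω := by
  rw [freeSurplus, h.claimCount_arrivalTime, Finset.sum_range_succ]
  ring

lemma freeSurplus_of_lt (h : IsRegularPath W U ω) {t : ℝ} (ht : t < arrivalTime W 0 ω) :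
    freeSurplus p W U x t ω = x + p * t := by
  have : claimCount W t ω = 0 := by simpa using h.claimCount_le_iff.2 ht
  simp [freeSurplus, this]

end IsRegularPath

end Path

/-! ### Laws of arrival times and claims, almost sure regularity -/

section Model

variable {Ω : Type*} [MeasurableSpace Ω] {μ : Measure Ω} {β : ℝ} {W U : ℕ → Ω → ℝ}

lemma mgf_expMeasure {q : ℝ} (hβ : 0 < β) (hq : 0 < q) :
    ∫ y, Real.exp (-q * y) ∂(expMeasure β) = β / (q + β) := by
  have hd : expMeasure β = volume.withDensity (exponentialPDF β) := rfl
  have hm : Measurable (exponentialPDF β) := (measurable_exponentialPDFReal β).ennreal_ofReal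
  rw [hd, integral_withDensity_eq_integral_toReal_smul hm (by simp [exponentialPDF])]
  have : (fun y => (exponentialPDF β y).toReal • Real.exp (-q * y)) =
      (Ici 0).indicator fun y => β * Real.exp (-(q + β) * y) := by
    ext y
    by_cases hy : 0 ≤ y
    · rw [exponentialPDF_of_nonneg hy, ENNReal.toReal_ofReal (by positivity),
        indicator_of_mem (mem_Ici.2 hy), smul_eq_mul, mul_assoc, ← Real.exp_add]
      ring_nf
    · rw [exponentialPDF_of_neg (not_le.1 hy), indicator_of_notMem (by simpa using hy)]
      simp
  rw [this, integral_indicator measurableSet_Ici, integral_Ici_eq_integral_Ioi,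
    integral_const_mul, integral_exp_mul_Ioi (by linarith)]
  have : q + β ≠ 0 := by positivity
  simp only [mul_zero, Real.exp_zero]
  field_simp

lemma expMeasure_Iic_zero (hβ : 0 < β) : expMeasure β (Iic 0) = 0 := by
  have := isProbabilityMeasure_expMeasure hβ
  rw [← ofReal_cdf, cdf_expMeasure_eq hβ]
  simp

lemma measure_claim_Ioc_le [IsProbabilityMeasure μ] {K : ℝ≥0}
    (hU : Measurable (U 0)) (hF : LipschitzWith K (claimCDF μ U)) {a b : ℝ} (hab : a ≤ b) :
    μ.map (U 0) (Ioc a b) ≤ ENNReal.ofReal (K * (b - a)) := by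
  have := Measure.isProbabilityMeasure_map (μ := μ) hU.aemeasurable
  have h1 : μ.map (U 0) (Ioc a b) = μ.map (U 0) (Iic b) - μ.map (U 0) (Iic a) := by
    rw [← Iic_sdiff_Iic, measure_sdiff (Iic_subset_Iic.2 hab) measurableSet_Iic.nullMeasurableSet
      (measure_ne_top _ _)]
  rw [h1, ← ofReal_cdf, ← ofReal_cdf, ← ENNReal.ofReal_sub _ (cdf_nonneg _ _)]
  refine ENNReal.ofReal_le_ofReal ?_
  have := hF.dist_le_mul b a
  simp only [claimCDF, Real.dist_eq, abs_of_nonneg (sub_nonneg.2 hab)] at this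
  exact (le_abs_self _).trans this

namespace IsCramerLundberg

lemma measurable_arrivalTime (hm : IsCramerLundberg μ β W U) (n : ℕ) :
    Measurable (arrivalTime W n) :=
  Finset.measurable_fun_sum _ fun i _ => hm.measurable_wait i

lemma integral_exp_arrivalTime {q : ℝ} (hm : IsCramerLundberg μ β W U) (hβ : 0 < β) (hq : 0 < q)
    (n : ℕ) : ∫ ω, Real.exp (-q * arrivalTime W n ω) ∂μ = (β / (q + β)) ^ (n + 1) := by
  have hind : iIndepFun W μ := hm.indep.precomp (g := Sum.inl) Sum.inl_injective
  have h1 := hind.mgf_sum (t := -q) hm.measurable_wait (Finset.range (n + 1))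
  have h2 : ∀ i, mgf (W i) μ (-q) = β / (q + β) := fun i => by
    rw [← mgf_expMeasure hβ hq, ← hm.law_wait i,
      integral_map (hm.measurable_wait i).aemeasurable (by fun_prop)]
    rfl
  simp only [h2, Finset.prod_const, Finset.card_range] at h1
  rw [← h1, mgf]
  simp [arrivalTime]

lemma ae_wait_pos (hm : IsCramerLundberg μ β W U) (hβ : 0 < β) : ∀ᵐ ω ∂μ, ∀ i, 0 < W i ω := by
  refine ae_all_iff.2 fun i => ?_
  have h := expMeasure_Iic_zero hβ
  rw [← hm.law_wait i, Measure.map_apply (hm.measurable_wait i) measurableSet_Iic] at h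
  simpa [ae_iff, preimage, not_lt] using h

/-- Non-explosion is an exponential Markov bound: the probability that all arrivals occur by time
`m` is at most `e^m (β / (1 + β)) ^ (n + 1)` for every `n`. -/
lemma ae_isRegularPath [IsProbabilityMeasure μ] (hm : IsCramerLundberg μ β W U) (hβ : 0 < β) :
    ∀ᵐ ω ∂μ, IsRegularPath W U ω := by
  have hT : ∀ᵐ ω ∂μ, ∀ m : ℕ, ∃ n, (m : ℝ) < arrivalTime W n ω := by
    refine ae_all_iff.2 fun m => ?_
    have hint : ∀ n, Integrable (fun ω => Real.exp (-1 * arrivalTime W n ω)) μ := fun n => by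
      -- A non-integrable function has integral `0` by convention, which contradicts the positive
      -- value of the transform.
      by_contra hc
      have := hm.integral_exp_arrivalTime hβ one_pos n
      rw [integral_undef hc] at this
      have : 0 < (β / (1 + β)) ^ (n + 1) := by positivity
      linarith
    have hlt : β / (1 + β) < 1 := by rw [div_lt_one (by linarith)]; linarith
    have hlim : Tendsto (fun n : ℕ => (β / (1 + β)) ^ (n + 1) / Real.exp (-m)) atTop (𝓝 0) := by
      simpa using ((tendsto_add_atTop_iff_nat 1).2
        (tendsto_pow_atTop_nhds_zero_of_lt_one (by positivity) hlt)).div_const (Real.exp (-m))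
    have hbound : ∀ n, μ.real {ω | ∀ n, arrivalTime W n ω ≤ m} ≤
        (β / (1 + β)) ^ (n + 1) / Real.exp (-m) := fun n => by
      rw [le_div_iff₀ (Real.exp_pos _), mul_comm, ← hm.integral_exp_arrivalTime hβ one_pos n]
      refine le_trans ?_ (mul_meas_ge_le_integral_of_nonneg
        (Eventually.of_forall fun ω => (Real.exp_pos _).le) (hint n) (Real.exp (-m)))
      refine mul_le_mul_of_nonneg_left (measureReal_mono fun ω hω => ?_) (Real.exp_pos _).le
      simpa using hω n
    have h0 := ge_of_tendsto' hlim hbound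
    have h1 : μ.real {ω | ∀ n, arrivalTime W n ω ≤ m} = 0 := le_antisymm h0 measureReal_nonneg
    rw [measureReal_eq_zero_iff] at h1
    simpa [ae_iff] using h1
  filter_upwards [hm.ae_wait_pos hβ, ae_all_iff.2 hm.claim_nonneg, hT] with ω hW hU hT
  refine ⟨hW, hU, ?_⟩
  have hmono : Monotone fun n => arrivalTime W n ω := monotone_nat_of_le_succ fun n => by
    rw [arrivalTime_succ]
    linarith [hW (n + 1)]
  refine tendsto_atTop_atTop_of_monotone hmono fun b => ?_
  obtain ⟨m, hb⟩ := exists_nat_ge b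
  obtain ⟨n, hn⟩ := hT m
  exact ⟨n, hb.trans hn.le⟩

lemma measurable_claimCount (hm : IsCramerLundberg μ β W U) (t : ℝ) :
    Measurable (claimCount W t) := by
  have h1 : Measurable fun ω => ((claimCount W t ω : ℕ) : ℝ) := by
    -- The identity holds for every outcome, also when infinitely many claims occur: both `ncard`
    -- and `ENNReal.toReal` send infinity to `0`.
    have : (fun ω => ((claimCount W t ω : ℕ) : ℝ)) = fun ω =>
        (∑' n : ℕ, {ω | arrivalTime W n ω ≤ t}.indicator (fun _ => (1 : ENNReal)) ω).toReal := by
      ext ω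
      have : (∑' n : ℕ, {ω | arrivalTime W n ω ≤ t}.indicator (fun _ => (1 : ENNReal)) ω) =
          ({n : ℕ | arrivalTime W n ω ≤ t}.encard : ENNReal) := by
        rw [← ENNReal.tsum_set_one]
        exact (tsum_subtype {n : ℕ | arrivalTime W n ω ≤ t} fun _ => (1 : ENNReal)).symm
      rw [this, claimCount, ncard]
      cases h : {n : ℕ | arrivalTime W n ω ≤ t}.encard <;> simp
    rw [this]
    refine (Measurable.tsum fun n => measurable_const.indicator ?_).ennreal_toReal
    exact measurableSet_le (hm.measurable_arrivalTime n) measurable_const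
  refine measurable_to_countable' fun n => ?_
  have := h1 (measurableSet_singleton (n : ℝ))
  convert this using 1
  ext ω
  simp

lemma measurable_freeSurplus (hm : IsCramerLundberg μ β W U) (p x t : ℝ) :
    Measurable (freeSurplus p W U x t) := by
  refine measurable_const.sub ?_
  have h : Measurable fun z : ℕ × Ω => ∑ i ∈ Finset.range z.1, U i z.2 :=
    measurable_from_prod_countable_right fun n =>
      Finset.measurable_fun_sum (Finset.range n) fun i _ => hm.measurable_claim i
  exact h.comp ((hm.measurable_claimCount t).prodMk measurable_id)

lemma surplusSigma_le (hm : IsCramerLundberg μ β W U) (p x t : ℝ) :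
    surplusSigma μ p W U x t ≤ ‹MeasurableSpace Ω› :=
  sup_le (iSup₂_le fun s _ => (hm.measurable_freeSurplus p x s).comap_le)
    (MeasurableSpace.generateFrom_le fun _ h => h.1)

/-- A Lipschitz distribution function has no atoms; the atom at `0` is squeezed by the intervals
`(-1/(n+1), 0]`. This makes the first claim ruinous when the surplus is zero. -/
lemma ae_claim_pos [IsProbabilityMeasure μ] {K : ℝ≥0} (hm : IsCramerLundberg μ β W U)
    (hF : LipschitzWith K (claimCDF μ U)) : ∀ᵐ ω ∂μ, 0 < U 0 ω := by
  have h0 : μ.map (U 0) {0} = 0 := by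
    have hlim : Tendsto (fun n : ℕ => ENNReal.ofReal (K * (0 - -(1 / ((n : ℝ) + 1))))) atTop
        (𝓝 (ENNReal.ofReal (K * (0 - -0)))) :=
      ENNReal.tendsto_ofReal ((tendsto_one_div_add_atTop_nhds_zero_nat.neg.const_sub _).const_mul _)
    simp only [neg_zero, sub_zero, mul_zero, ENNReal.ofReal_zero] at hlim
    refine le_antisymm (ge_of_tendsto' hlim fun n => ?_) zero_le
    have hn : (0 : ℝ) < 1 / ((n : ℝ) + 1) := by positivity
    refine le_trans (measure_mono ?_)
      (measure_claim_Ioc_le (hm.measurable_claim 0) hF (neg_nonpos.2 hn.le))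
    simp [hn, -one_div]
  rw [Measure.map_apply (hm.measurable_claim 0) (measurableSet_singleton _)] at h0
  have h1 : ∀ᵐ ω ∂μ, U 0 ω ≠ 0 := by simpa [ae_iff, preimage] using h0
  filter_upwards [h1, hm.claim_nonneg 0] with ω h h'
  exact lt_of_le_of_ne h' (Ne.symm h)

end IsCramerLundberg

end Model

/-! ### Measurability of right-continuous processes and their time integrals -/

section RightContinuous

variable {Ω : Type*} {m : MeasurableSpace Ω} {g : ℝ → Ω → ℝ}

/-- The time `s` is approximated from the right by the grid point `(⌊(n+1)s⌋ + 1)/(n+1)`, which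
takes countably many values; right continuity gives the limit. -/
lemma measurable_uncurry_of_rightContinuous (hg : ∀ t, 0 ≤ t → Measurable (g t))
    (hrc : ∀ ω t, 0 ≤ t → ContinuousWithinAt (fun s => g s ω) (Ici t) t) :
    Measurable fun z : ℝ × Ω => g (max z.1 0) z.2 := by
  have hfloor : ∀ n : ℕ, Measurable fun z : ℝ × Ω =>
      g ((⌊((n : ℝ) + 1) * max z.1 0⌋₊ + 1 : ℝ) / (n + 1)) z.2 := fun n => by
    have h : Measurable fun z : ℕ × Ω => g ((z.1 + 1 : ℝ) / (n + 1)) z.2 :=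
      measurable_from_prod_countable_right fun k => hg ((k + 1 : ℝ) / (n + 1)) (by positivity)
    have h2 : Measurable fun z : ℝ × Ω => (⌊((n : ℝ) + 1) * max z.1 0⌋₊, z.2) :=
      (Nat.measurable_floor.comp (by fun_prop)).prodMk measurable_snd
    exact h.comp h2
  refine measurable_of_tendsto_metrizable hfloor (tendsto_pi_nhds.2 fun z => ?_)
  set s := max z.1 0 with hs
  have hs0 : 0 ≤ s := le_max_right _ _
  refine (hrc z.2 s hs0).tendsto.comp (tendsto_nhdsWithin_iff.2 ⟨?_, ?_⟩)
  · have hlim : Tendsto (fun n : ℕ => s + 1 / ((n : ℝ) + 1)) atTop (𝓝 s) := by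
      simpa using tendsto_one_div_add_atTop_nhds_zero_nat.const_add s
    refine tendsto_of_tendsto_of_tendsto_of_le_of_le tendsto_const_nhds hlim
      (fun n => ?_) fun n => ?_
    · have hn : (0 : ℝ) < n + 1 := by positivity
      simp only
      rw [le_div_iff₀ hn, mul_comm]
      exact (Nat.lt_floor_add_one _).le
    · have hn : (0 : ℝ) < n + 1 := by positivity
      simp only
      have : (s + 1 / ((n : ℝ) + 1)) * (n + 1) = (n + 1) * s + 1 := by field_simp
      rw [div_le_iff₀ hn, this]
      linarith [Nat.floor_le (mul_nonneg hn.le hs0)]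
  · refine Eventually.of_forall fun n => ?_
    have hn : (0 : ℝ) < n + 1 := by positivity
    rw [mem_Ici, le_div_iff₀ hn, mul_comm]
    exact (Nat.lt_floor_add_one _).le

lemma measurable_integral_of_rightContinuous (hg : ∀ t, 0 ≤ t → Measurable (g t))
    (hrc : ∀ ω t, 0 ≤ t → ContinuousWithinAt (fun s => g s ω) (Ici t) t) :
    Measurable fun ω => ∫ s in Ioi (0 : ℝ), g s ω := by
  have h := (measurable_uncurry_of_rightContinuous hg hrc).stronglyMeasurable
  have h2 := (h.integral_prod_left' (μ := volume.restrict (Ioi (0 : ℝ)))).measurable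
  convert h2 using 2 with ω
  exact setIntegral_congr_fun measurableSet_Ioi fun s hs => by
    simp [max_eq_left (le_of_lt (mem_Ioi.1 hs))]

end RightContinuous

/-! ### Independence of a claim from the surplus just before it -/

/-- The σ-algebra generated by all waiting times and all claims other than claim `k`. -/
@[reducible] def otherSigma {Ω : Type*} (W U : ℕ → Ω → ℝ) (k : ℕ) : MeasurableSpace Ω :=
  ⨆ i ∈ ({Sum.inr k}ᶜ : Set (ℕ ⊕ ℕ)), MeasurableSpace.comap (Sum.elim W U i) inferInstance

/-- The σ-algebra of all sets whose intersection with the measurable set `D` is measurable. -/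
@[reducible] def traceSigma {Ω : Type*} (m : MeasurableSpace Ω) (D : Set Ω)
    (hD : MeasurableSet D) : MeasurableSpace Ω where
  MeasurableSet' A := MeasurableSet (A ∩ D)
  measurableSet_empty := by simp
  measurableSet_compl A hA := by
    have : Aᶜ ∩ D = D \ (A ∩ D) := by ext; simp; tauto
    rw [this]
    exact hD.diff hA
  measurableSet_iUnion f hf := by
    rw [iUnion_inter]
    exact MeasurableSet.iUnion hf

/-- The surplus immediately before claim `k` under the strategy `C`. -/
noncomputable def preClaimSurplus {Ω : Type*} (p : ℝ) (W U : ℕ → Ω → ℝ) (x : ℝ)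
    (C : ℝ → Ω → ℝ) (k : ℕ) (ω : Ω) : ℝ :=
  x + p * arrivalTime W k ω - ∑ i ∈ Finset.range k, U i ω -
    ∫ s in Ioi (0 : ℝ), if s < arrivalTime W k ω then C s ω else 0

section Other

variable {Ω : Type*} {W U : ℕ → Ω → ℝ}

lemma measurable_wait_otherSigma (k i : ℕ) : Measurable[otherSigma W U k] (W i) :=
  Measurable.mono (comap_measurable (Sum.elim W U (Sum.inl i)))
    (le_iSup₂_of_le (Sum.inl i) (by simp) le_rfl) le_rfl

lemma measurable_claim_otherSigma {k i : ℕ} (h : i ≠ k) : Measurable[otherSigma W U k] (U i) :=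
  Measurable.mono (comap_measurable (Sum.elim W U (Sum.inr i)))
    (le_iSup₂_of_le (Sum.inr i) (by simpa using h) le_rfl) le_rfl

lemma measurable_arrivalTime_otherSigma (k i : ℕ) :
    Measurable[otherSigma W U k] (arrivalTime W i) :=
  @Finset.measurable_fun_sum _ _ _ (_) _ _ (otherSigma W U k) _ _
    fun j _ => measurable_wait_otherSigma k j

/-- The σ-algebra is left free because two are needed: the ambient one, and the null-set completion
of `otherSigma W U k` that yields independence. Only values of `C` before the arrival enter. -/
lemma measurable_preClaimSurplus_of {m : MeasurableSpace Ω} {p x : ℝ} {C : ℝ → Ω → ℝ} {k : ℕ}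
    (hT : Measurable (arrivalTime W k)) (hU : ∀ i < k, Measurable (U i))
    (hC : ∀ t, 0 ≤ t → Measurable fun ω => if t < arrivalTime W k ω then C t ω else 0)
    (hrc : ∀ ω t, 0 ≤ t →
      ContinuousWithinAt (fun s => if s < arrivalTime W k ω then C s ω else 0) (Ici t) t) :
    Measurable (preClaimSurplus p W U x C k) :=
  (((hT.const_mul p).const_add x).sub
    (Finset.measurable_fun_sum _ fun i hi => hU i (Finset.mem_range.1 hi))).sub
    (measurable_integral_of_rightContinuous hC hrc)

end Other

section Integral

variable {Ω : Type*} [MeasurableSpace Ω] {μ : Measure Ω} {β p cbar x c : ℝ} {W U : ℕ → Ω → ℝ}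
  {C : ℝ → Ω → ℝ}

/-- As long as claim `k` has not arrived, the observed surplus involves only arrival times and
claims of smaller index. Completion by `ae μ` absorbs the null events in the filtration and the
irregular paths. -/
lemma measurableSet_surplusSigma_inter [IsProbabilityMeasure μ] (hm : IsCramerLundberg μ β W U)
    (hβ : 0 < β) (k : ℕ) (t : ℝ) {A : Set Ω} (hA : MeasurableSet[surplusSigma μ p W U x t] A) :
    MeasurableSet[eventuallyMeasurableSpace (otherSigma W U k) (ae μ)]
      (A ∩ {ω | t < arrivalTime W k ω}) := by
  set D := {ω | t < arrivalTime W k ω} with hD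
  have hD0 : MeasurableSet[otherSigma W U k] D := by
    let _ := otherSigma W U k
    exact measurableSet_lt measurable_const (measurable_arrivalTime_otherSigma k k)
  suffices h : surplusSigma μ p W U x t ≤ traceSigma (eventuallyMeasurableSpace (otherSigma W U k)
    (ae μ)) D (le_eventuallyMeasurableSpace _ hD0) from h A hA
  refine sup_le (iSup₂_le fun s hs => ?_) (MeasurableSpace.generateFrom_le fun A hA => ?_)
  · rintro _ ⟨B, hB, rfl⟩
    -- `Z` is the free surplus with claims from index `k` on deleted; it is measurable without `U k`
    -- and agrees with the free surplus on regular paths in `D`.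
    let Z : Ω → ℝ := fun ω => x + p * s -
      ∑ i ∈ Finset.range k, {ω | arrivalTime W i ω ≤ s}.indicator (U i) ω
    have hZ : Measurable[otherSigma W U k] Z := by
      let _ := otherSigma W U k
      refine measurable_const.sub (Finset.measurable_fun_sum _ fun i hi => ?_)
      refine Measurable.indicator (measurable_claim_otherSigma (Finset.mem_range.1 hi).ne) ?_
      exact measurable_arrivalTime_otherSigma k i measurableSet_Iic
    refine ⟨Z ⁻¹' B ∩ D, MeasurableSet.inter (hZ hB) hD0, ?_⟩
    filter_upwards [hm.ae_isRegularPath hβ] with ω h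
    refine propext (and_congr_left fun hω => ?_)
    have hk : claimCount W s ω ≤ k := h.claimCount_le_iff.2 (lt_of_le_of_lt hs.2 hω)
    have : freeSurplus p W U x s ω = Z ω := by
      simp only [freeSurplus, Z]
      congr 1
      rw [← Finset.sum_subset (Finset.range_subset_range.2 hk)]
      · refine Finset.sum_congr rfl fun i hi => ?_
        rw [indicator_of_mem]
        exact h.lt_claimCount_iff.1 (Finset.mem_range.1 hi)
      · intro i _ hi
        rw [indicator_of_notMem]
        simpa [← h.lt_claimCount_iff] using hi
    change freeSurplus p W U x s ω ∈ B ↔ Z ω ∈ B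
    rw [this]
  · refine ⟨∅, @MeasurableSet.empty _ (otherSigma W U k), ?_⟩
    have : μ (A ∩ D) = 0 := measure_mono_null inter_subset_left hA.2
    exact ae_eq_empty.2 this

namespace IsAdmissible

lemma rightContinuous_truncate (hC : IsAdmissible μ p cbar W U x c C) (T : ℝ) (ω : Ω)
    (t : ℝ) (ht : 0 ≤ t) :
    ContinuousWithinAt (fun s => if s < T then C s ω else 0) (Ici t) t := by
  by_cases h : t < T
  · refine (hC.right_cont ω t ht).congr_of_eventuallyEq ?_ (if_pos h)
    filter_upwards [nhdsWithin_le_nhds (Iio_mem_nhds h)] with s hs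
    exact if_pos hs
  · refine continuousWithinAt_const.congr (fun s hs => if_neg ?_) (if_neg h)
    exact not_lt.2 ((not_lt.1 h).trans hs)

lemma measurable (hm : IsCramerLundberg μ β W U) (hC : IsAdmissible μ p cbar W U x c C) {t : ℝ}
    (ht : 0 ≤ t) : Measurable (C t) :=
  (hC.adapted t ht).mono (hm.surplusSigma_le p x t) le_rfl

lemma measurable_preClaimSurplus (hm : IsCramerLundberg μ β W U)
    (hC : IsAdmissible μ p cbar W U x c C) (k : ℕ) : Measurable (preClaimSurplus p W U x C k) := by
  refine measurable_preClaimSurplus_of (hm.measurable_arrivalTime k)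
    (fun i _ => hm.measurable_claim i) (fun t ht => ?_)
    fun ω t ht => hC.rightContinuous_truncate _ ω t ht
  exact Measurable.ite (measurableSet_lt measurable_const (hm.measurable_arrivalTime k))
    (hC.measurable hm ht) measurable_const

lemma eventuallyMeasurable_preClaimSurplus [IsProbabilityMeasure μ] (hm : IsCramerLundberg μ β W U)
    (hβ : 0 < β) (hC : IsAdmissible μ p cbar W U x c C) (k : ℕ) :
    Measurable[eventuallyMeasurableSpace (otherSigma W U k) (ae μ)]
      (preClaimSurplus p W U x C k) := by
  have hle : otherSigma W U k ≤ eventuallyMeasurableSpace (otherSigma W U k) (ae μ) :=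
    le_eventuallyMeasurableSpace
  have hT := (measurable_arrivalTime_otherSigma (W := W) (U := U) k k).mono hle le_rfl
  refine measurable_preClaimSurplus_of hT
    (fun i hi => (measurable_claim_otherSigma hi.ne).mono hle le_rfl) (fun t ht => ?_)
    fun ω t ht => hC.rightContinuous_truncate _ ω t ht
  intro B hB
  have h1 := hT (measurableSet_Ioi (a := t))
  have h2 := measurableSet_surplusSigma_inter hm hβ k t (hC.adapted t ht hB)
  have : (fun ω => if t < arrivalTime W k ω then C t ω else 0) ⁻¹' B =
      (C t ⁻¹' B ∩ {ω | t < arrivalTime W k ω}) ∪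
        ((arrivalTime W k ⁻¹' Ioi t)ᶜ ∩ {_ω | (0 : ℝ) ∈ B}) := by
    ext ω
    by_cases h : t < arrivalTime W k ω <;> simp [h]
  rw [this]
  exact MeasurableSet.union h2 (MeasurableSet.inter (MeasurableSet.compl h1)
    (MeasurableSet.const _))

lemma indepFun_preClaimSurplus [IsProbabilityMeasure μ] (hm : IsCramerLundberg μ β W U)
    (hβ : 0 < β) (hC : IsAdmissible μ p cbar W U x c C) (k : ℕ) :
    IndepFun (preClaimSurplus p W U x C k) (U k) μ := by
  have hmeas : ∀ i, Measurable (Sum.elim W U i) :=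
    Sum.rec hm.measurable_wait hm.measurable_claim
  have hind : Indep (otherSigma W U k)
      (⨆ i ∈ ({Sum.inr k} : Set (ℕ ⊕ ℕ)), MeasurableSpace.comap (Sum.elim W U i) inferInstance) μ :=
    indep_iSup_of_disjoint (fun i => (hmeas i).comap_le) hm.indep disjoint_compl_left
  rw [indepFun_iff_measure_inter_preimage_eq_mul]
  intro A B hA hB
  obtain ⟨A', hA', hAA'⟩ := hC.eventuallyMeasurable_preClaimSurplus hm hβ k hA
  rw [measure_congr hAA', measure_congr (hAA'.inter (ae_eq_refl (U k ⁻¹' B)))]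
  refine (Indep_iff _ _ μ).1 hind A' _ hA' ?_
  rw [iSup_singleton]
  exact ⟨B, hB, rfl⟩

/-- By independence the joint law is a product, so the window is fixed while the claim is integrated
out; its length is `2 * δ`. -/
lemma measure_claim_mem_Ioc_le [IsProbabilityMeasure μ] {K : ℝ≥0} (hm : IsCramerLundberg μ β W U)
    (hβ : 0 < β) (hF : LipschitzWith K (claimCDF μ U)) (hC : IsAdmissible μ p cbar W U x c C)
    (k : ℕ) {δ : ℝ} (hδ : 0 ≤ δ) :
    μ {ω | U k ω ∈ Ioc (preClaimSurplus p W U x C k ω - δ) (preClaimSurplus p W U x C k ω + δ)} ≤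
      ENNReal.ofReal (K * (2 * δ)) := by
  have hY := hC.measurable_preClaimSurplus hm k
  have hind := (indepFun_iff_map_prod_eq_prod_map_map hY.aemeasurable
    (hm.measurable_claim k).aemeasurable).1 (hC.indepFun_preClaimSurplus hm hβ k)
  have hS : MeasurableSet {z : ℝ × ℝ | z.2 ∈ Ioc (z.1 - δ) (z.1 + δ)} :=
    (measurableSet_lt (measurable_fst.sub_const δ) measurable_snd).inter
      (measurableSet_le measurable_snd (measurable_fst.add_const δ))
  have := Measure.isProbabilityMeasure_map (μ := μ) hY.aemeasurable
  have := Measure.isProbabilityMeasure_map (μ := μ) (hm.measurable_claim k).aemeasurable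
  calc _ = μ.map (fun ω => (preClaimSurplus p W U x C k ω, U k ω))
        {z : ℝ × ℝ | z.2 ∈ Ioc (z.1 - δ) (z.1 + δ)} := by
        rw [Measure.map_apply (hY.prodMk (hm.measurable_claim k)) hS]
        rfl
    _ = ∫⁻ y, μ.map (U k) (Ioc (y - δ) (y + δ)) ∂μ.map (preClaimSurplus p W U x C k) := by
        rw [hind, Measure.prod_apply hS]
        rfl
    _ ≤ ∫⁻ _, ENNReal.ofReal (K * (2 * δ)) ∂μ.map (preClaimSurplus p W U x C k) := by
        refine lintegral_mono fun y => ?_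
        rw [hm.law_claim k]
        convert measure_claim_Ioc_le (hm.measurable_claim 0) hF
          (show y - δ ≤ y + δ by linarith) using 3
        ring
    _ = ENNReal.ofReal (K * (2 * δ)) := by simp

end IsAdmissible

end Integral

/-! ### Ruin time, payout and exponential integrals -/

/-- The discounted dividends paid until ruin. -/
noncomputable def discountedPayout {Ω : Type*} (p q : ℝ) (W U : ℕ → Ω → ℝ) (x : ℝ)
    (C : ℝ → Ω → ℝ) (ω : Ω) : ℝ :=
  ∫ s in {s : ℝ | 0 ≤ s ∧ (s : EReal) < ruinTime p W U x C ω}, Real.exp (-q * s) * C s ω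

section Ruin

variable {Ω : Type*} {p q x : ℝ} {W U : ℕ → Ω → ℝ} {C : ℝ → Ω → ℝ} {ω : Ω}

lemma ruinTime_le {t : ℝ} (ht : 0 ≤ t) (h : controlledSurplus p W U x C t ω < 0) :
    ruinTime p W U x C ω ≤ t :=
  iInf₂_le t ⟨ht, h⟩

lemma controlledSurplus_nonneg_of_lt_ruinTime {t : ℝ} (ht : 0 ≤ t)
    (h : (t : EReal) < ruinTime p W U x C ω) : 0 ≤ controlledSurplus p W U x C t ω :=
  not_lt.1 fun hc => not_le.2 h (ruinTime_le ht hc)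

lemma exists_of_ruinTime_lt {s : ℝ} (h : ruinTime p W U x C ω < s) :
    ∃ t, 0 ≤ t ∧ t < s ∧ controlledSurplus p W U x C t ω < 0 := by
  simp only [ruinTime, iInf_lt_iff] at h
  obtain ⟨t, ht, hts⟩ := h
  exact ⟨t, ht.1, by exact_mod_cast hts, ht.2⟩

lemma ruinTime_nonneg : 0 ≤ ruinTime p W U x C ω :=
  le_iInf₂ fun t ht => by exact_mod_cast ht.1

lemma ruinTime_eq_top_or_coe :
    ruinTime p W U x C ω = ⊤ ∨ ∃ a : ℝ, 0 ≤ a ∧ ruinTime p W U x C ω = a := by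
  have h := ruinTime_nonneg (p := p) (W := W) (U := U) (x := x) (C := C) (ω := ω)
  induction hτ : ruinTime p W U x C ω with
  | bot => simp [hτ] at h
  | top => exact Or.inl rfl
  | coe a => exact Or.inr ⟨a, by rw [hτ] at h; exact_mod_cast h, rfl⟩

lemma discountedPayout_eq : discountedPayout p q W U x C ω = ∫ s in Ioi (0 : ℝ),
    {s : ℝ | (s : EReal) < ruinTime p W U x C ω}.indicator
      (fun s => Real.exp (-q * s) * C s ω) s := by
  have hmeas : MeasurableSet {s : ℝ | (s : EReal) < ruinTime p W U x C ω} :=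
    measurable_coe_real_ereal measurableSet_Iio
  rw [← integral_Ici_eq_integral_Ioi, setIntegral_indicator hmeas]
  rfl

lemma controlledSurplus_zero (h : IsRegularPath W U ω) : controlledSurplus p W U x C 0 ω = x := by
  rw [controlledSurplus, h.freeSurplus_of_lt (h.arrivalTime_pos 0)]
  simp

lemma integral_truncate (C : ℝ → Ω → ℝ) (ω : Ω) {T : ℝ} (hT : 0 ≤ T) :
    ∫ s in Ioi (0 : ℝ), (if s < T then C s ω else 0) = ∫ s in (0 : ℝ)..T, C s ω := by
  have h : (fun s => if s < T then C s ω else 0) = (Iio T).indicator fun s => C s ω := by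
    ext s
    simp [indicator]
  rw [h, setIntegral_indicator measurableSet_Iio, Ioi_inter_Iio,
    intervalIntegral.integral_of_le hT, integral_Ioc_eq_integral_Ioo]

lemma controlledSurplus_arrivalTime (h : IsRegularPath W U ω) (k : ℕ) :
    controlledSurplus p W U x C (arrivalTime W k ω) ω = preClaimSurplus p W U x C k ω - U k ω := by
  rw [controlledSurplus, h.freeSurplus_arrivalTime, preClaimSurplus,
    integral_truncate C ω (h.arrivalTime_pos k).le]
  ring

end Ruin

section Exponential

variable {q : ℝ}

lemma integrableOn_exp_neg (hq : 0 < q) :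
    IntegrableOn (fun s => Real.exp (-q * s)) (Ioi 0) :=
  integrableOn_exp_mul_Ioi (by linarith) 0

lemma integral_exp_tail (hq : 0 < q) {M : ℝ} (hM : 0 ≤ M) :
    ∫ s in Ioi (0 : ℝ), (Ioi M).indicator (fun s => Real.exp (-q * s)) s =
      Real.exp (-q * M) / q := by
  rw [setIntegral_indicator measurableSet_Ioi, Ioi_inter_Ioi, sup_eq_right.2 hM,
    integral_exp_mul_Ioi (by linarith)]
  field_simp

lemma integral_exp_head (hq : 0 < q) {M : ℝ} (hM : 0 ≤ M) :
    ∫ s in Ioi (0 : ℝ), (Iio M).indicator (fun s => Real.exp (-q * s)) s =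
      (1 - Real.exp (-q * M)) / q := by
  have h1 := integral_exp_tail hq hM
  have h2 : ∫ s in Ioi (0 : ℝ), Real.exp (-q * s) = 1 / q := by
    rw [integral_exp_mul_Ioi (by linarith)]
    simp [neg_div]
  have h3 := integral_add_compl (μ := volume.restrict (Ioi (0 : ℝ)))
    (measurableSet_Iic (a := M)) (integrableOn_exp_neg hq)
  rw [← integral_indicator measurableSet_Iic, ← integral_indicator measurableSet_Iic.compl,
    compl_Iic, h1, h2] at h3
  have h4 : (Iic M).indicator (fun s => Real.exp (-q * s)) =ᵐ[volume.restrict (Ioi 0)]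
      (Iio M).indicator (fun s => Real.exp (-q * s)) :=
    ae_restrict_of_ae (indicator_ae_eq_of_ae_eq_set Iio_ae_eq_Iic.symm)
  rw [← integral_congr_ae h4]
  rw [sub_div]
  linarith

end Exponential

/-! ### Drift bounds and measurable payout for admissible strategies -/

namespace IsAdmissible

variable {Ω : Type*} [MeasurableSpace Ω] {μ : Measure Ω} {β p q cbar x c : ℝ} {W U : ℕ → Ω → ℝ}
  {C : ℝ → Ω → ℝ} {ω : Ω}

lemma intervalIntegrable (hC : IsAdmissible μ p cbar W U x c C) (ω : Ω) {a b : ℝ} (ha : 0 ≤ a)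
    (hb : 0 ≤ b) : IntervalIntegrable (fun s => C s ω) volume a b :=
  ((hC.mono ω).mono fun _ hs => (le_min ha hb).trans hs.1).intervalIntegrable

lemma controlledSurplus_sub (hC : IsAdmissible μ p cbar W U x c C) {t s : ℝ}
    (ht : 0 ≤ t) (hs : 0 ≤ s) :
    controlledSurplus p W U x C s ω - controlledSurplus p W U x C t ω =
      freeSurplus p W U x s ω - freeSurplus p W U x t ω - ∫ r in t..s, C r ω := by
  rw [← intervalIntegral.integral_add_adjacent_intervals (hC.intervalIntegrable ω ht le_rfl)
    (hC.intervalIntegrable ω le_rfl hs), intervalIntegral.integral_symm]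
  simp only [controlledSurplus]
  ring

/-- Ratcheting is used here: a rate at least `a` at time `t` stays at least `a`, and claims only
lower the surplus. -/
lemma controlledSurplus_le (hC : IsAdmissible μ p cbar W U x c C) (h : IsRegularPath W U ω)
    {t s a : ℝ} (ht : 0 ≤ t) (hts : t ≤ s) (ha : a ≤ C t ω) :
    controlledSurplus p W U x C s ω ≤ controlledSurplus p W U x C t ω + (p - a) * (s - t) := by
  have h1 := hC.controlledSurplus_sub (ω := ω) ht (ht.trans hts)
  have h2 := h.freeSurplus_le (p := p) (x := x) hts
  have h3 : ∫ _ in t..s, a ≤ ∫ r in t..s, C r ω :=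
    intervalIntegral.integral_mono_on hts (by simp)
      (hC.intervalIntegrable ω ht (ht.trans hts)) fun r hr =>
        ha.trans (hC.mono ω ht (ht.trans hr.1) hr.1)
  rw [intervalIntegral.integral_const, smul_eq_mul] at h3
  linarith

/-- The converse use of ratcheting: the final rate dominates all earlier ones, and without claims
only the drift acts. -/
lemma le_controlledSurplus (hC : IsAdmissible μ p cbar W U x c C)
    {t s a : ℝ} (ht : 0 ≤ t) (hts : t ≤ s) (ha : C s ω ≤ a)
    (hN : claimCount W s ω = claimCount W t ω) :
    controlledSurplus p W U x C t ω + (p - a) * (s - t) ≤ controlledSurplus p W U x C s ω := by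
  have h1 := hC.controlledSurplus_sub (ω := ω) ht (ht.trans hts)
  have h2 : freeSurplus p W U x s ω = freeSurplus p W U x t ω + p * (s - t) := by
    simp only [freeSurplus, hN]
    ring
  have h3 : ∫ r in t..s, C r ω ≤ ∫ _ in t..s, a :=
    intervalIntegral.integral_mono_on hts (hC.intervalIntegrable ω ht (ht.trans hts)) (by simp)
      fun r hr => (hC.mono ω (ht.trans hr.1) (ht.trans hts) hr.2).trans ha
  rw [intervalIntegral.integral_const, smul_eq_mul] at h3
  linarith

lemma measurable_controlledSurplus (hm : IsCramerLundberg μ β W U)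
    (hC : IsAdmissible μ p cbar W U x c C) {t : ℝ} (ht : 0 ≤ t) :
    Measurable (controlledSurplus p W U x C t) := by
  refine (hm.measurable_freeSurplus p x t).sub ?_
  simp_rw [← integral_truncate C _ ht]
  refine measurable_integral_of_rightContinuous (fun s hs => ?_)
    fun ω s hs => hC.rightContinuous_truncate _ ω s hs
  split_ifs
  exacts [hC.measurable hm hs, measurable_const]

/-- If the dividend rate has not exceeded `p + η` by time `t`, then the surplus at time `t` is
almost as large as the initial surplus or the surplus right after some claim. -/
lemma le_surplus_or_exists_claim (hC : IsAdmissible μ p cbar W U x c C) (h : IsRegularPath W U ω)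
    {t η : ℝ} (ht : 0 ≤ t) (hη : 0 ≤ η) (hCt : C t ω ≤ p + η) :
    x - η * t ≤ controlledSurplus p W U x C t ω ∨ ∃ k, arrivalTime W k ω ≤ t ∧
      controlledSurplus p W U x C (arrivalTime W k ω) ω ≤
        controlledSurplus p W U x C t ω + η * t := by
  rcases hN : claimCount W t ω with _ | k
  · left
    have h0 : claimCount W 0 ω = 0 := by
      simpa using h.claimCount_le_iff.2 (h.arrivalTime_pos 0)
    have := hC.le_controlledSurplus (p := p) (x := x) le_rfl ht hCt (hN.trans h0.symm)
    rw [controlledSurplus_zero h] at this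
    linarith
  · right
    have hk : arrivalTime W k ω ≤ t := h.lt_claimCount_iff.1 (by omega)
    refine ⟨k, hk, ?_⟩
    have hpos := h.arrivalTime_pos k
    have := hC.le_controlledSurplus (p := p) (x := x) hpos.le hk hCt
      (hN.trans (h.claimCount_arrivalTime k).symm)
    nlinarith [mul_nonneg hη hpos.le]

lemma integrableOn_payout (hC : IsAdmissible μ p cbar W U x c C) (hc : 0 ≤ c) (hq : 0 < q) (ω : Ω)
    {S : Set ℝ} (hS : MeasurableSet S) :
    IntegrableOn (S.indicator fun s => Real.exp (-q * s) * C s ω) (Ioi 0) := by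
  refine Integrable.indicator ?_ hS
  have h1 : AEMeasurable (fun s => C s ω) (volume.restrict (Ioi 0)) :=
    aemeasurable_restrict_of_monotoneOn measurableSet_Ioi
      ((hC.mono ω).mono Ioi_subset_Ici_self)
  refine ((integrableOn_exp_neg hq).mul_const cbar).mono'
    ((by fun_prop : Measurable fun s => Real.exp (-q * s)).aemeasurable.mul
      h1).aestronglyMeasurable ?_
  filter_upwards [ae_restrict_mem measurableSet_Ioi] with s hs
  have := hC.mem_Icc ω s (le_of_lt hs)
  rw [norm_mul, Real.norm_eq_abs, Real.norm_eq_abs, Real.abs_exp,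
    abs_of_nonneg (hc.trans this.1)]
  exact mul_le_mul_of_nonneg_left this.2 (Real.exp_pos _).le

lemma discountedPayout_nonneg (hC : IsAdmissible μ p cbar W U x c C) (hc : 0 ≤ c) (ω : Ω) :
    0 ≤ discountedPayout p q W U x C ω := by
  rw [discountedPayout_eq]
  refine setIntegral_nonneg measurableSet_Ioi fun s hs => ?_
  rw [indicator_apply]
  split_ifs
  · exact mul_nonneg (Real.exp_pos _).le (hc.trans (hC.mem_Icc ω s (le_of_lt hs)).1)
  · exact le_rfl

lemma discountedPayout_le (hC : IsAdmissible μ p cbar W U x c C) (hc : 0 ≤ c) (hq : 0 < q)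
    (ω : Ω) : discountedPayout p q W U x C ω ≤ cbar / q := by
  have hmeas : MeasurableSet {s : ℝ | (s : EReal) < ruinTime p W U x C ω} :=
    measurable_coe_real_ereal measurableSet_Iio
  have hexp : ∫ s in Ioi (0 : ℝ), Real.exp (-q * s) * cbar = cbar / q := by
    rw [integral_mul_const, integral_exp_mul_Ioi (by linarith)]
    simp
    field_simp
  rw [discountedPayout_eq, ← hexp]
  refine setIntegral_mono_on (hC.integrableOn_payout hc hq ω hmeas)
    ((integrableOn_exp_neg hq).mul_const cbar) measurableSet_Ioi fun s hs => ?_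
  have h := hC.mem_Icc ω s (le_of_lt hs)
  refine indicator_apply_le' (fun _ => ?_) fun _ => ?_
  · exact mul_le_mul_of_nonneg_left h.2 (Real.exp_pos _).le
  · exact mul_nonneg (Real.exp_pos _).le (hc.trans (h.1.trans h.2))

lemma aestronglyMeasurable_discountedPayout [IsProbabilityMeasure μ]
    (hm : IsCramerLundberg μ β W U) (hβ : 0 < β) (hp : 0 < p)
    (hC : IsAdmissible μ p cbar W U x c C) (hc : 0 ≤ c) :
    AEStronglyMeasurable (discountedPayout p q W U x C) μ := by
  -- Survival tested at rational times only, which makes it jointly measurable. It agrees with `s <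
  -- τ` except possibly at `s = τ`, a null set of times: a negative surplus rises at most at speed
  -- `p`, so it is still negative at some slightly later rational time.
  let S : Set (ℝ × Ω) := {z | ∀ r : ℚ, (0 : ℝ) ≤ r → (r : ℝ) < z.1 →
    0 ≤ controlledSurplus p W U x C r z.2}
  have hS : MeasurableSet S := by
    have : S = ⋂ r : ℚ, {z | (0 : ℝ) ≤ r → (r : ℝ) < z.1 →
      0 ≤ controlledSurplus p W U x C r z.2} := by
      ext z
      simp [S]
    rw [this]
    refine MeasurableSet.iInter fun r => ?_
    by_cases hr : (0 : ℝ) ≤ r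
    · simp only [hr, imp_iff_not_or, not_lt, not_true, false_or]
      refine (measurableSet_le measurable_fst (measurable_const (a := (r : ℝ)))).union (measurableSet_le
        measurable_const ((hC.measurable_controlledSurplus hm hr).comp measurable_snd))
    · simp [hr]
  have hG : Measurable (S.indicator fun z : ℝ × Ω => Real.exp (-q * z.1) * C (max z.1 0) z.2) :=
    ((by fun_prop : Measurable fun z : ℝ × Ω => Real.exp (-q * z.1)).mul
      (measurable_uncurry_of_rightContinuous (fun t ht => hC.measurable hm ht)
        hC.right_cont)).indicator hS
  refine (hG.stronglyMeasurable.integral_prod_left'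
    (μ := volume.restrict (Ioi (0 : ℝ)))).aestronglyMeasurable.congr ?_
  filter_upwards [hm.ae_isRegularPath hβ] with ω h
  rw [discountedPayout_eq]
  have hne : ∀ᵐ s : ℝ, (s : EReal) ≠ ruinTime p W U x C ω := by
    have : {s : ℝ | (s : EReal) = ruinTime p W U x C ω}.Subsingleton := fun a ha b hb =>
      EReal.coe_injective (ha.trans hb.symm)
    simpa [ae_iff] using this.measure_zero volume
  refine setIntegral_congr_ae measurableSet_Ioi ?_
  filter_upwards [hne] with s hs hs0
  have hiff : (s, ω) ∈ S ↔ s ∈ {s : ℝ | (s : EReal) < ruinTime p W U x C ω} := by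
    constructor
    · intro hsS
      by_contra hlt
      obtain ⟨t, ht, hts, hneg⟩ :=
        exists_of_ruinTime_lt (lt_of_le_of_ne (not_lt.1 hlt) (Ne.symm hs))
      have hd : 0 < -controlledSurplus p W U x C t ω / p := div_pos (neg_pos.2 hneg) hp
      obtain ⟨r, hr1, hr2⟩ := exists_rat_btwn
        (lt_min hts (lt_add_of_pos_right t hd))
      have h1 := hsS r (ht.trans hr1.le) (hr2.trans_le (min_le_left _ _))
      have h2 := hC.controlledSurplus_le (p := p) (x := x) h ht hr1.le
        (hc.trans (hC.mem_Icc ω t ht).1)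
      have h3 : (r : ℝ) - t < -controlledSurplus p W U x C t ω / p := by
        linarith [hr2.trans_le (min_le_right _ _)]
      rw [lt_div_iff₀ hp] at h3
      linarith
    · intro hlt r hr hrs
      exact controlledSurplus_nonneg_of_lt_ruinTime hr
        (lt_trans (by exact_mod_cast hrs) hlt)
  by_cases hmem : (s, ω) ∈ S
  · rw [indicator_of_mem hmem, indicator_of_mem (hiff.1 hmem),
      max_eq_left (le_of_lt (mem_Ioi.1 hs0))]
  · rw [indicator_of_notMem hmem, indicator_of_notMem (fun h' => hmem (hiff.2 h'))]

end IsAdmissible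

/-! ### Comparing a strategy with its shadow -/

/-- Claim `k` lands the surplus within `δ` of zero. -/
def nearRuinClaim {Ω : Type*} (p : ℝ) (W U : ℕ → Ω → ℝ) (x : ℝ) (C : ℝ → Ω → ℝ) (δ : ℝ) (k : ℕ) :
    Set Ω :=
  {ω | U k ω ∈ Ioc (preClaimSurplus p W U x C k ω - δ) (preClaimSurplus p W U x C k ω + δ)}

/-- `D` is close enough to `C` up to the horizon `M`, and avoids rates slightly larger than `p`. -/
structure IsShadow {Ω : Type*} (p : ℝ) (W U : ℕ → Ω → ℝ) (x x' : ℝ) (C D : ℝ → Ω → ℝ)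
    (δ ε η M : ℝ) : Prop where
  eps_pos : 0 < ε
  delta_pos : 0 < δ
  eta_nonneg : 0 ≤ η
  horizon_nonneg : 0 ≤ M
  eta_le_delta : η * M ≤ δ
  eta_le_surplus : η * M ≤ x
  surplus_le : ∀ ω t, 0 ≤ t → t ≤ M →
    controlledSurplus p W U x' C t ω ≤ controlledSurplus p W U x D t ω + δ
  rate_le : ∀ ω t, 0 ≤ t → C t ω ≤ D t ω + ε
  rate_gap : ∀ ω t, 0 ≤ t → D t ω ≤ p + η ∨ p + ε ≤ D t ω

section Comparison

variable {Ω : Type*} [MeasurableSpace Ω] {μ : Measure Ω} {β p q cbar x x' c c' δ ε η M : ℝ}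
  {W U : ℕ → Ω → ℝ} {C D : ℝ → Ω → ℝ} {ω : Ω}

/-- The core of the comparison: if `D` is ruined more than `δ / ε` before a time that `C` survives,
a claim must be to blame. -/
lemma IsShadow.exists_nearRuinClaim (hS : IsShadow p W U x x' C D δ ε η M)
    (hD : IsAdmissible μ p cbar W U x c D)
    (h : IsRegularPath W U ω) {s t : ℝ} {n : ℕ} (ht : 0 ≤ t) (hts : t + δ / ε < s) (hsM : s ≤ M)
    (hsn : s ≤ arrivalTime W n ω) (hs : (s : EReal) < ruinTime p W U x' C ω)
    (hneg : controlledSurplus p W U x D t ω < 0) :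
    ∃ k < n, ω ∈ nearRuinClaim p W U x D δ k := by
  have hρ : 0 < δ / ε := div_pos hS.delta_pos hS.eps_pos
  have hts' : t < s := by linarith
  rcases hS.rate_gap ω t ht with hlow | hhigh
  · have htM : η * t ≤ η * M := mul_le_mul_of_nonneg_left (by linarith) hS.eta_nonneg
    -- At a low rate the surplus has lost at most `η * M` since the start or the last claim. The
    -- start is excluded by `η * M ≤ x`. After the claim, the surplus of `D` is below `δ`, and at
    -- least `-δ` because `C` survives it.
    rcases hD.le_surplus_or_exists_claim h ht hS.eta_nonneg hlow with h0 | ⟨k, hk, hle⟩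
    · linarith [hS.eta_le_surplus]
    · refine ⟨k, h.strictMono_arrivalTime.lt_iff_lt.1 (show arrivalTime W k ω < arrivalTime W n ω by
        linarith), ?_⟩
      have hk0 := h.arrivalTime_pos k
      have h1 := controlledSurplus_nonneg_of_lt_ruinTime hk0.le
        (lt_trans (by exact_mod_cast (by linarith : arrivalTime W k ω < s)) hs)
      have h2 := hS.surplus_le ω _ hk0.le (by linarith)
      have h3 := hS.eta_le_delta
      rw [controlledSurplus_arrivalTime (C := D) h] at hle h2
      constructor <;> linarith
  -- At a high rate the surplus of `D` drops by more than `δ` between `t` and `s`, so that of `C`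
  -- would be negative at `s`.
  · have h1 := hD.controlledSurplus_le h ht hts'.le hhigh
    have h2 := controlledSurplus_nonneg_of_lt_ruinTime (by linarith) hs
    have h3 := hS.surplus_le ω s (by linarith) hsM
    have h4 : δ < (s - t) * ε := by
      rw [← div_lt_iff₀ hS.eps_pos]
      linarith
    linarith

lemma integral_Icc_indicator_le {a ρ : ℝ} (hρ : 0 ≤ ρ) :
    ∫ s in Ioi (0 : ℝ), (Icc a (a + ρ)).indicator (fun _ => (1 : ℝ)) s ≤ ρ := by
  rw [setIntegral_indicator measurableSet_Icc, setIntegral_const, smul_eq_mul, mul_one]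
  calc _ ≤ volume.real (Icc a (a + ρ)) := measureReal_mono inter_subset_right (by simp)
    _ = ρ := by simp [Real.volume_real_Icc, hρ]

/-- The payout of `C` exceeds that of a shadow `D` by little, unless some early claim lands the
surplus near zero. -/
lemma IsShadow.discountedPayout_le (hS : IsShadow p W U x x' C D δ ε η M) (hq : 0 < q)
    (hc : 0 ≤ c) (hc' : 0 ≤ c') (hcbar : 0 ≤ cbar)
    (hC : IsAdmissible μ p cbar W U x' c' C) (hD : IsAdmissible μ p cbar W U x c D)
    (h : IsRegularPath W U ω) (n : ℕ) :
    discountedPayout p q W U x' C ω ≤ discountedPayout p q W U x D ω + ε / q +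
      cbar * (δ / ε) + cbar / q * (Real.exp (-q * M) + Real.exp (-q * arrivalTime W n ω) +
        ∑ k ∈ Finset.range n, (nearRuinClaim p W U x D δ k).indicator (fun _ => (1 : ℝ)) ω) := by
  set b := ∑ k ∈ Finset.range n, (nearRuinClaim p W U x D δ k).indicator (fun _ => (1 : ℝ)) ω
    with hb
  have hb0 : 0 ≤ b := Finset.sum_nonneg fun k _ => indicator_nonneg (fun _ _ => zero_le_one) _
  have hρ : 0 < δ / ε := div_pos hS.delta_pos hS.eps_pos
  -- `a` is the ruin time of `D`; when `D` is never ruined it is a dummy value, and the extra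
  -- nonnegative term in the bound does no harm.
  obtain ⟨a, ha⟩ : ∃ a : ℝ, ruinTime p W U x D ω = ⊤ ∨ ruinTime p W U x D ω = a := by
    rcases ruinTime_eq_top_or_coe (p := p) (W := W) (U := U) (x := x) (C := D) (ω := ω) with
      h | ⟨a, -, h⟩
    exacts [⟨0, Or.inl h⟩, ⟨a, Or.inr h⟩]
  have hmeas : ∀ (y : ℝ) (B : ℝ → Ω → ℝ),
      MeasurableSet {s : ℝ | (s : EReal) < ruinTime p W U y B ω} := fun y B =>
    measurable_coe_real_ereal measurableSet_Iio
  have hexp := integrableOn_exp_neg hq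
  have i1 := hD.integrableOn_payout hc hq ω (hmeas x D)
  have i2 : IntegrableOn (fun s => (ε + cbar * b) * Real.exp (-q * s)) (Ioi 0) :=
    hexp.const_mul _
  have i3 : IntegrableOn (fun s => cbar * (Icc a (a + δ / ε)).indicator (fun _ => (1 : ℝ)) s)
      (Ioi 0) :=
    ((integrable_indicator_iff measurableSet_Icc).2 (integrableOn_const (hs := by
      rw [Measure.restrict_apply measurableSet_Icc]
      exact ((measure_mono inter_subset_left).trans_lt measure_Icc_lt_top).ne))).const_mul _
  have i4 : ∀ T : ℝ, IntegrableOn (fun s => cbar *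
      (Ioi T).indicator (fun s => Real.exp (-q * s)) s) (Ioi 0) := fun T =>
    (Integrable.indicator hexp measurableSet_Ioi).const_mul _
  -- Pointwise bound in `s`. While `D` is alive only the rate loss counts. Otherwise `s` lies in the
  -- grace period of length `δ / ε` after its ruin, beyond `M`, beyond the `n`-indexed arrival, or a
  -- near-ruin claim has occurred and `1 ≤ b`.
  have key : ∀ s ∈ Ioi (0 : ℝ),
      {s : ℝ | (s : EReal) < ruinTime p W U x' C ω}.indicator
        (fun s => Real.exp (-q * s) * C s ω) s ≤
      {s : ℝ | (s : EReal) < ruinTime p W U x D ω}.indicator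
        (fun s => Real.exp (-q * s) * D s ω) s + (ε + cbar * b) * Real.exp (-q * s) +
      cbar * (Icc a (a + δ / ε)).indicator (fun _ => (1 : ℝ)) s +
      cbar * (Ioi M).indicator (fun s => Real.exp (-q * s)) s +
      cbar * (Ioi (arrivalTime W n ω)).indicator (fun s => Real.exp (-q * s)) s := by
    intro s hs
    have hs0 : 0 ≤ s := le_of_lt hs
    have hE := Real.exp_pos (-q * s)
    have hE1 : Real.exp (-q * s) ≤ 1 := Real.exp_le_one_iff.2 (by nlinarith)
    have hCs := hC.mem_Icc ω s hs0
    have hDs := hD.mem_Icc ω s hs0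
    have e1 : 0 ≤ {s : ℝ | (s : EReal) < ruinTime p W U x D ω}.indicator
        (fun s => Real.exp (-q * s) * D s ω) s := by
      rw [indicator_apply]
      split_ifs
      exacts [mul_nonneg hE.le (hc.trans hDs.1), le_rfl]
    have e2 : 0 ≤ (ε + cbar * b) * Real.exp (-q * s) := by
      have := hS.eps_pos
      positivity
    have e3 : 0 ≤ cbar * (Icc a (a + δ / ε)).indicator (fun _ => (1 : ℝ)) s :=
      mul_nonneg hcbar (indicator_nonneg (fun _ _ => zero_le_one) _)
    have e4 : ∀ T, 0 ≤ cbar * (Ioi T).indicator (fun s => Real.exp (-q * s)) s := fun T =>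
      mul_nonneg hcbar (indicator_nonneg (fun _ _ => (Real.exp_pos _).le) _)
    have e5 := e4 M
    have e6 := e4 (arrivalTime W n ω)
    have hub : Real.exp (-q * s) * C s ω ≤ cbar * Real.exp (-q * s) := by
      rw [mul_comm]
      exact mul_le_mul_of_nonneg_right hCs.2 hE.le
    by_cases hsC : (s : EReal) < ruinTime p W U x' C ω
    swap
    · rw [indicator_of_notMem (show s ∉ {s : ℝ | (s : EReal) < ruinTime p W U x' C ω} from hsC)]
      linarith
    rw [indicator_of_mem (show s ∈ {s : ℝ | (s : EReal) < ruinTime p W U x' C ω} from hsC)]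
    by_cases hsD : (s : EReal) < ruinTime p W U x D ω
    · rw [indicator_of_mem (show s ∈ {s : ℝ | (s : EReal) < ruinTime p W U x D ω} from hsD)]
      have h1 := mul_le_mul_of_nonneg_left (hS.rate_le ω s hs0) hE.le
      have h2 : 0 ≤ cbar * b * Real.exp (-q * s) := by positivity
      linarith
    rcases ha with ha | ha
    · exact absurd (by rw [ha]; exact EReal.coe_lt_top s) hsD
    have has : a ≤ s := by
      rw [ha] at hsD
      exact_mod_cast not_lt.1 hsD
    by_cases hsa : s ≤ a + δ / ε
    · rw [indicator_of_mem (show s ∈ Icc a (a + δ / ε) from ⟨has, hsa⟩)] at e3 ⊢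
      have : cbar * Real.exp (-q * s) ≤ cbar * 1 := mul_le_mul_of_nonneg_left hE1 hcbar
      linarith
    by_cases hsM : M < s
    · rw [indicator_of_mem (show s ∈ Ioi M from hsM)] at e5 ⊢
      linarith
    by_cases hsn : arrivalTime W n ω < s
    · rw [indicator_of_mem (show s ∈ Ioi (arrivalTime W n ω) from hsn)] at e6 ⊢
      linarith
    have hlt : ruinTime p W U x D ω < ((s - δ / ε : ℝ) : EReal) := by
      rw [ha]
      exact_mod_cast (by linarith : a < s - δ / ε)
    obtain ⟨t, ht, hts, hneg⟩ := exists_of_ruinTime_lt hlt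
    obtain ⟨k, hk, hω⟩ := hS.exists_nearRuinClaim hD h ht (by linarith) (not_lt.1 hsM)
      (not_lt.1 hsn) hsC hneg
    have hb1 : 1 ≤ b := by
      have := Finset.single_le_sum
        (f := fun k => (nearRuinClaim p W U x D δ k).indicator (fun _ => (1 : ℝ)) ω)
        (fun k _ => indicator_nonneg (fun _ _ => zero_le_one) _) (Finset.mem_range.2 hk)
      simpa [indicator_of_mem hω] using this
    have h1 : cbar * 1 * Real.exp (-q * s) ≤ cbar * b * Real.exp (-q * s) := by gcongr
    have h2 : 0 ≤ ε * Real.exp (-q * s) := mul_nonneg hS.eps_pos.le hE.le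
    linarith
  have hint := setIntegral_mono_on (hC.integrableOn_payout hc' hq ω (hmeas x' C))
    ((((i1.add i2).add i3).add (i4 M)).add (i4 (arrivalTime W n ω))) measurableSet_Ioi key
  rw [integral_add' (((i1.add i2).add i3).add (i4 M)) (i4 _), integral_add' ((i1.add i2).add i3) (i4 M),
    integral_add' (i1.add i2) i3, integral_add' i1 i2, integral_const_mul, integral_const_mul,
    integral_const_mul, integral_const_mul, integral_exp_tail hq hS.horizon_nonneg,
    integral_exp_tail hq (h.arrivalTime_pos n).le, ← discountedPayout_eq, ← discountedPayout_eq,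
    integral_exp_mul_Ioi (by linarith)] at hint
  have h1 := mul_le_mul_of_nonneg_left (integral_Icc_indicator_le (a := a) hρ.le) hcbar
  have h2 : (ε + cbar * b) * (-Real.exp (-q * 0) / -q) = ε / q + cbar / q * b := by
    simp only [mul_zero, Real.exp_zero]
    field_simp
  have h3 : ∀ T, cbar * (Real.exp (-q * T) / q) = cbar / q * Real.exp (-q * T) := fun T => by ring
  rw [h2, h3, h3] at hint
  linarith

lemma IsAdmissible.integrable_discountedPayout [IsProbabilityMeasure μ]
    (hm : IsCramerLundberg μ β W U) (hβ : 0 < β) (hp : 0 < p) (hq : 0 < q)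
    (hC : IsAdmissible μ p cbar W U x c C) (hc : 0 ≤ c) :
    Integrable (discountedPayout p q W U x C) μ := by
  refine Integrable.of_bound (hC.aestronglyMeasurable_discountedPayout hm hβ hp hc) (cbar / q)
    (Eventually.of_forall fun ω => ?_)
  rw [Real.norm_eq_abs, abs_of_nonneg (hC.discountedPayout_nonneg hc ω)]
  exact hC.discountedPayout_le hc hq ω

lemma IsAdmissible.strategyValue_le [IsProbabilityMeasure μ]
    (hm : IsCramerLundberg μ β W U) (hβ : 0 < β) (hp : 0 < p) (hq : 0 < q)
    (hC : IsAdmissible μ p cbar W U x c C) (hc : 0 ≤ c) :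
    strategyValue μ p q W U x C ≤ cbar / q := by
  have := integral_mono (hC.integrable_discountedPayout hm hβ hp hq hc)
    (integrable_const (cbar / q)) fun ω => hC.discountedPayout_le hc hq ω
  rw [integral_const, probReal_univ, one_smul] at this
  exact this

lemma IsCramerLundberg.integrable_exp_arrivalTime (hm : IsCramerLundberg μ β W U) (hβ : 0 < β)
    (hq : 0 < q) (n : ℕ) : Integrable (fun ω => Real.exp (-q * arrivalTime W n ω)) μ := by
  by_contra hc
  have := hm.integral_exp_arrivalTime hβ hq n
  rw [integral_undef hc] at this
  have : 0 < (β / (q + β)) ^ (n + 1) := by positivity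
  linarith

/-- Expectation of the pathwise bound; the last term is a union bound over the first `n` claims. -/
lemma IsShadow.strategyValue_le [IsProbabilityMeasure μ] {K : ℝ≥0}
    (hm : IsCramerLundberg μ β W U) (hβ : 0 < β) (hp : 0 < p)
    (hF : LipschitzWith K (claimCDF μ U))
    (hS : IsShadow p W U x x' C D δ ε η M) (hq : 0 < q)
    (hc : 0 ≤ c) (hc' : 0 ≤ c') (hcbar : 0 ≤ cbar)
    (hC : IsAdmissible μ p cbar W U x' c' C) (hD : IsAdmissible μ p cbar W U x c D) (n : ℕ) :
    strategyValue μ p q W U x' C ≤ strategyValue μ p q W U x D + ε / q + cbar * (δ / ε) +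
      cbar / q * (Real.exp (-q * M) + (β / (q + β)) ^ (n + 1) + n * (K * (2 * δ))) := by
  have iC := hC.integrable_discountedPayout hm hβ hp hq hc'
  have iD := hD.integrable_discountedPayout hm hβ hp hq hc
  have iT := hm.integrable_exp_arrivalTime hβ hq n
  have hB : ∀ k, MeasurableSet (nearRuinClaim p W U x D δ k) := fun k => by
    have hY := hD.measurable_preClaimSurplus hm k
    exact (measurableSet_lt (hY.sub_const δ) (hm.measurable_claim k)).inter
      (measurableSet_le (hm.measurable_claim k) (hY.add_const δ))
  have iB : ∀ k, Integrable ((nearRuinClaim p W U x D δ k).indicator (fun _ => (1 : ℝ))) μ :=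
    fun k => (integrable_const 1).indicator (hB k)
  have hBle : ∀ k, ∫ ω, (nearRuinClaim p W U x D δ k).indicator (fun _ => (1 : ℝ)) ω ∂μ ≤
      K * (2 * δ) := fun k => by
    rw [integral_indicator (hB k), setIntegral_const, smul_eq_mul, mul_one]
    have := hS.delta_pos
    exact ENNReal.toReal_le_of_le_ofReal (by positivity)
      (hD.measure_claim_mem_Ioc_le hm hβ hF k this.le)
  have iSum := integrable_finsetSum (Finset.range n) fun k _ => iB k
  have iK : ∀ a : ℝ, Integrable (fun _ : Ω => a) μ := integrable_const
  have i2 := ((iK (Real.exp (-q * M))).add iT).add iSum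
  have hle := integral_mono_ae iC (((iD.add (iK (ε / q))).add (iK (cbar * (δ / ε)))).add
      (i2.const_mul (cbar / q)))
    (by
      filter_upwards [hm.ae_isRegularPath hβ] with ω h
      exact hS.discountedPayout_le hq hc hc' hcbar hC hD h n)
  rw [integral_add' ((iD.add (iK _)).add (iK _)) (i2.const_mul _),
    integral_add' (iD.add (iK _)) (iK _), integral_add' iD (iK _), integral_const_mul (cbar / q),
    integral_add' ((iK _).add iT) iSum, integral_add' (iK _) iT,
    integral_finsetSum _ fun k _ => iB k, hm.integral_exp_arrivalTime hβ hq] at hle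
  simp only [integral_const, probReal_univ, one_smul] at hle
  have hsum := Finset.sum_le_sum fun k (_ : k ∈ Finset.range n) => hBle k
  rw [Finset.sum_const, Finset.card_range, nsmul_eq_mul] at hsum
  refine hle.trans ?_
  have : (0 : ℝ) ≤ cbar / q := by positivity
  exact add_le_add_right (mul_le_mul_of_nonneg_left (add_le_add_right hsum _) this) _

end Comparison

/-! ### Construction of the shadow strategy and continuity of the value function -/

/-- Rates below `p + ε` are capped at `m`; larger rates are kept. -/
noncomputable def snapRate (p ε m y : ℝ) : ℝ := if y < p + ε then min y m else y

/-- The strategy obtained from `C` by raising it to at least `c` and removing rates slightly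
larger than `p`. -/
noncomputable def shadowStrategy {Ω : Type*} (p ε c : ℝ) (C : ℝ → Ω → ℝ) (t : ℝ) (ω : Ω) : ℝ :=
  snapRate p ε (max p c) (max (C t ω) c)

section Snap

variable {p ε m : ℝ}

lemma snapRate_le (y : ℝ) : snapRate p ε m y ≤ y := by
  unfold snapRate
  split_ifs
  exacts [min_le_left _ _, le_rfl]

lemma monotone_snapRate : Monotone (snapRate p ε m) := by
  intro y z hyz
  unfold snapRate
  split_ifs with h1 h2 h2
  · exact min_le_min_right m hyz
  · exact (min_le_left _ _).trans hyz
  · exact absurd (hyz.trans_lt h2) h1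
  · exact hyz

lemma continuousAt_snapRate {y : ℝ} (hy : y < p + ε) : ContinuousAt (snapRate p ε m) y := by
  have : snapRate p ε m =ᶠ[𝓝 y] fun y => min y m := by
    filter_upwards [Iio_mem_nhds hy] with z hz
    exact if_pos hz
  exact ContinuousAt.congr (by fun_prop) this.symm

end Snap

section Shadow

variable {Ω : Type*} [MeasurableSpace Ω] {μ : Measure Ω} {β p q cbar x x' c c' δ ε η M : ℝ}
  {W U : ℕ → Ω → ℝ} {C : ℝ → Ω → ℝ} {ω : Ω}

/-- Free surpluses from two starting points differ by a constant, so a strategy may be transported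
from one initial surplus to another. -/
lemma surplusSigma_le_surplusSigma (x x' t : ℝ) :
    surplusSigma μ p W U x t ≤ surplusSigma μ p W U x' t := by
  refine sup_le_sup (iSup₂_mono fun s _ => ?_) le_rfl
  have h : freeSurplus p W U x s = (fun y => y + (x - x')) ∘ freeSurplus p W U x' s := by
    ext ω
    simp only [freeSurplus, Function.comp]
    ring
  rw [h, ← MeasurableSpace.comap_comp]
  exact MeasurableSpace.comap_mono (Measurable.comap_le (by fun_prop))

lemma isAdmissible_const (hc : c ≤ cbar) : IsAdmissible μ p cbar W U x c fun _ _ => c where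
  adapted _ _ := measurable_const
  right_cont _ _ _ := continuousWithinAt_const
  left_lim _ _ _ := ⟨c, tendsto_const_nhds⟩
  mono _ := monotoneOn_const
  mem_Icc _ _ _ := ⟨le_rfl, hc⟩

lemma exists_tendsto_nhdsLT_of_monotoneOn {f : ℝ → ℝ} (hf : MonotoneOn f (Ici 0)) {t : ℝ}
    (ht : 0 < t) : ∃ l, Tendsto f (𝓝[<] t) (𝓝 l) := by
  have hg : Monotone fun s => f (max s 0) := fun a b hab =>
    hf (le_max_right a 0) (le_max_right b 0) (max_le_max_right 0 hab)
  refine ⟨_, (hg.tendsto_nhdsLT t).congr' ?_⟩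
  filter_upwards [nhdsWithin_le_nhds (Ioi_mem_nhds ht)] with s hs
  rw [max_eq_left (le_of_lt (mem_Ioi.1 hs))]

lemma IsAdmissible.shadowStrategy (hC : IsAdmissible μ p cbar W U x' c' C)
    (hc : c ≤ cbar) : IsAdmissible μ p cbar W U x c (shadowStrategy p ε c C) := by
  have hmono : Monotone (snapRate p ε (max p c)) :=
    monotone_snapRate
  have hmonoOn : ∀ ω, MonotoneOn (fun s => DividendRatcheting.shadowStrategy p ε c C s ω) (Ici 0) :=
    fun ω a ha b hb hab => hmono (max_le_max_right c (hC.mono ω ha hb hab))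
  refine ⟨fun t ht => ?_, fun ω t ht => ?_, fun ω t ht =>
    exists_tendsto_nhdsLT_of_monotoneOn (hmonoOn ω) ht, hmonoOn, fun ω t ht => ⟨?_, ?_⟩⟩
  · have h1 := (hC.adapted t ht).mono (surplusSigma_le_surplusSigma x' x t) le_rfl
    exact hmono.measurable.comp (h1.max measurable_const)
  · have hcont : ContinuousWithinAt (fun s => max (C s ω) c) (Ici t) t :=
      (hC.right_cont ω t ht).max continuousWithinAt_const
    -- `snapRate` may jump at `p + ε`, but once this level is reached the monotone rate stays on the
    -- branch where nothing is changed.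
    by_cases hy : max (C t ω) c < p + ε
    · exact ContinuousAt.comp_continuousWithinAt (f := fun s => max (C s ω) c)
        (continuousAt_snapRate hy) hcont
    · have h : ∀ s ∈ Ici t, DividendRatcheting.shadowStrategy p ε c C s ω = max (C s ω) c :=
        fun s hs => if_neg (not_lt.2 ((not_lt.1 hy).trans
          (max_le_max_right c (hC.mono ω ht (ht.trans hs) hs))))
      exact hcont.congr h (h t self_mem_Ici)
  · unfold DividendRatcheting.shadowStrategy snapRate
    split_ifs with h
    · exact le_min (le_max_right _ _) (le_max_right _ _)
    · exact le_max_right _ _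
  · exact (snapRate_le _).trans (max_le (hC.mem_Icc ω t ht).2 hc)

/-- Since `C` is at least `c'`, raising it to `c` costs at most `max (c - c') 0` per unit time, and
snapping only lowers the rate; this is the origin of `hclose`. -/
lemma IsAdmissible.isShadow (hC : IsAdmissible μ p cbar W U x' c' C) (hc : c ≤ cbar)
    (hε : 0 < ε) (hδ : 0 < δ) (hη : 0 ≤ η) (hM : 0 ≤ M) (hηδ : η * M ≤ δ) (hηx : η * M ≤ x)
    (hclose : x' - x + max (c - c') 0 * M ≤ δ) (hgap : c ≤ p + η ∨ p + ε ≤ c) :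
    IsShadow p W U x x' C (DividendRatcheting.shadowStrategy p ε c C) δ ε η M := by
  have hD := hC.shadowStrategy (x := x) (ε := ε) hc
  refine ⟨hε, hδ, hη, hM, hηδ, hηx, fun ω t ht htM => ?_, fun ω t ht => ?_, fun ω t ht => ?_⟩
  · have h1 : ∫ s in (0 : ℝ)..t, DividendRatcheting.shadowStrategy p ε c C s ω ≤
        ∫ s in (0 : ℝ)..t, (C s ω + max (c - c') 0) := by
      refine intervalIntegral.integral_mono_on ht (hD.intervalIntegrable ω le_rfl ht)
        ((hC.intervalIntegrable ω le_rfl ht).add (by simp)) fun s hs => ?_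
      refine (snapRate_le _).trans (max_le ?_ ?_)
      · linarith [le_max_right (c - c') 0]
      · linarith [le_max_left (c - c') 0, (hC.mem_Icc ω s hs.1).1]
    rw [intervalIntegral.integral_add (hC.intervalIntegrable ω le_rfl ht) (by simp),
      intervalIntegral.integral_const, smul_eq_mul] at h1
    have h2 := mul_le_mul_of_nonneg_left htM (le_max_right (c - c') 0)
    simp only [controlledSurplus, freeSurplus]
    linarith
  · unfold DividendRatcheting.shadowStrategy snapRate
    have h1 := le_max_left (C t ω) c
    split_ifs with h
    · rw [← min_add_add_right]
      refine le_min (by linarith) ?_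
      linarith [le_max_left p c]
    · linarith
  · unfold DividendRatcheting.shadowStrategy snapRate
    split_ifs with h
    · rcases hgap with hgap | hgap
      · left
        exact (min_le_right _ _).trans (max_le (by linarith) hgap)
      · exact absurd h (not_lt.2 (hgap.trans (le_max_right _ _)))
    · exact Or.inr (not_lt.1 h)

lemma valueFunction_le_of_forall (hc : c ≤ cbar) {b : ℝ}
    (h : ∀ C, IsAdmissible μ p cbar W U x c C → strategyValue μ p q W U x C ≤ b) :
    valueFunction μ p q cbar W U x c ≤ b :=
  csSup_le (Nonempty.image _ ⟨_, isAdmissible_const hc⟩) (by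
    rintro _ ⟨C, hC, rfl⟩
    exact h C hC)

variable [IsProbabilityMeasure μ]

lemma bddAbove_strategyValue (hm : IsCramerLundberg μ β W U) (hβ : 0 < β) (hp : 0 < p)
    (hq : 0 < q) (hc : 0 ≤ c) :
    BddAbove (strategyValue μ p q W U x '' {C | IsAdmissible μ p cbar W U x c C}) :=
  ⟨cbar / q, by
    rintro _ ⟨C, hC, rfl⟩
    exact IsAdmissible.strategyValue_le hm hβ hp hq hC hc⟩

lemma strategyValue_le_valueFunction (hm : IsCramerLundberg μ β W U) (hβ : 0 < β) (hp : 0 < p)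
    (hq : 0 < q) (hc : 0 ≤ c) (hC : IsAdmissible μ p cbar W U x c C) :
    strategyValue μ p q W U x C ≤ valueFunction μ p q cbar W U x c :=
  le_csSup (bddAbove_strategyValue hm hβ hp hq hc) ⟨C, hC, rfl⟩

/-- Quantitative form of the continuity of the value function. -/
lemma valueFunction_le_add {K : ℝ≥0} (hm : IsCramerLundberg μ β W U) (hβ : 0 < β) (hp : 0 < p)
    (hq : 0 < q) (hF : LipschitzWith K (claimCDF μ U)) (hc : c ∈ Icc 0 cbar) (hc' : c' ∈ Icc 0 cbar)
    (hε : 0 < ε) (hδ : 0 < δ) (hη : 0 ≤ η) (hM : 0 ≤ M) (hηδ : η * M ≤ δ) (hηx : η * M ≤ x)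
    (hclose : x' - x + max (c - c') 0 * M ≤ δ) (hgap : c ≤ p + η ∨ p + ε ≤ c) (n : ℕ) :
    valueFunction μ p q cbar W U x' c' ≤ valueFunction μ p q cbar W U x c + ε / q +
      cbar * (δ / ε) + cbar / q * (Real.exp (-q * M) + (β / (q + β)) ^ (n + 1) +
        n * (K * (2 * δ))) := by
  refine valueFunction_le_of_forall hc'.2 fun C hC => ?_
  have hS := hC.isShadow hc.2 hε hδ hη hM hηδ hηx hclose hgap
  have hD := hC.shadowStrategy (x := x) (ε := ε) hc.2
  have h1 := hS.strategyValue_le hm hβ hp hF hq hc.1 hc'.1 (hc.1.trans hc.2) hC hD n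
  have h2 := strategyValue_le_valueFunction hm hβ hp hq hc.1 hD
  linarith

/-- The error is split into four quarters of `e`. The order of choice matters: `ε`, `M` and `n` come
before `δ`, which must beat both `1 / ε` and `n`, and the radius `d` comes last. The bound is
uniform over both points near `(x₀, c₀)`, so exchanging them gives two-sided continuity. -/
lemma exists_forall_valueFunction_le_add {K : ℝ≥0} (hm : IsCramerLundberg μ β W U) (hβ : 0 < β)
    (hp : 0 < p) (hq : 0 < q) (hF : LipschitzWith K (claimCDF μ U))
    {x₀ c₀ e : ℝ} (hx₀ : 0 ≤ x₀) (hne : (x₀, c₀) ≠ (0, p)) (he : 0 < e) :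
    ∃ d > 0, ∀ x x' c c', 0 ≤ x → c ∈ Icc 0 cbar → c' ∈ Icc 0 cbar → |x - x₀| < d →
      |x' - x₀| < d → |c - c₀| < d → |c' - c₀| < d →
      valueFunction μ p q cbar W U x' c' < valueFunction μ p q cbar W U x c + e := by
  obtain ⟨ε, hε, hεe, hεc⟩ : ∃ ε > 0, ε / q < e / 4 ∧ (p < c₀ → ε ≤ (c₀ - p) / 2) := by
    have h0 : 0 < e / 8 * q := by positivity
    have h1 : e / 8 * q / q < e / 4 := by
      rw [mul_div_cancel_right₀ _ hq.ne']
      linarith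
    by_cases hpc : p < c₀
    · refine ⟨min (e / 8 * q) ((c₀ - p) / 2), lt_min h0 (by linarith), ?_, fun _ => min_le_right _ _⟩
      exact lt_of_le_of_lt (div_le_div_of_nonneg_right (min_le_left _ _) hq.le) h1
    · exact ⟨_, h0, h1, fun h => absurd h hpc⟩
  obtain ⟨M, hM, hMe⟩ : ∃ M, 0 ≤ M ∧ cbar / q * Real.exp (-q * M) < e / 4 := by
    have hlim : Tendsto (fun M => cbar / q * Real.exp (-q * M)) atTop (𝓝 (cbar / q * 0)) :=
      (Real.tendsto_exp_atBot.comp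
        (tendsto_id.const_mul_atTop_of_neg (neg_neg_of_pos hq))).const_mul _
    rw [mul_zero] at hlim
    exact ((eventually_ge_atTop 0).and (hlim.eventually (gt_mem_nhds (by positivity)))).exists
  obtain ⟨n, hn⟩ : ∃ n : ℕ, cbar / q * (β / (q + β)) ^ (n + 1) < e / 4 := by
    have hlt : β / (q + β) < 1 := by rw [div_lt_one (by linarith)]; linarith
    have hlim := (((tendsto_add_atTop_iff_nat 1).2
      (tendsto_pow_atTop_nhds_zero_of_lt_one (by positivity) hlt)).const_mul (cbar / q))
    rw [mul_zero] at hlim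
    exact (hlim.eventually (gt_mem_nhds (by positivity))).exists
  obtain ⟨δ, hδ, hδe⟩ : ∃ δ, 0 < δ ∧
      cbar * (δ / ε) + cbar / q * (n * (K * (2 * δ))) < e / 4 := by
    have hcont : Continuous fun δ : ℝ => cbar * (δ / ε) + cbar / q * (n * (K * (2 * δ))) := by
      fun_prop
    have hlim := hcont.tendsto 0
    simp only [zero_div, mul_zero, add_zero] at hlim
    have hev := (hlim.mono_left nhdsWithin_le_nhds : Tendsto _ (𝓝[>] (0 : ℝ)) _).eventually
      (gt_mem_nhds (show 0 < e / 4 by positivity))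
    exact (eventually_mem_nhdsWithin.and hev).exists
  obtain ⟨d, hd, hdδ, hd2⟩ : ∃ d > 0, 2 * d * (1 + M) ≤ δ ∧ ∀ x c, 0 ≤ x → |x - x₀| < d →
      |c - c₀| < d → ∃ η, 0 ≤ η ∧ η * M ≤ δ ∧ η * M ≤ x ∧ (c ≤ p + η ∨ p + ε ≤ c) := by
    have hd1 : 0 < δ / (2 * (1 + M)) := by positivity
    have hd1' : ∀ d, d ≤ δ / (2 * (1 + M)) → 2 * d * (1 + M) ≤ δ := fun d h => by
      rw [le_div_iff₀ (by positivity)] at h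
      linarith
    -- Off the line `c₀ = p`, `η = 0` suffices: either `c ≤ p` nearby, or `ε ≤ (c₀ - p) / 2` leaves
    -- room for `p + ε ≤ c`.
    rcases lt_trichotomy c₀ p with h | h | h
    · refine ⟨min (δ / (2 * (1 + M))) (p - c₀), lt_min hd1 (by linarith),
        hd1' _ (min_le_left _ _), fun x c hx _ hc => ⟨0, le_rfl, by simpa using hδ.le, by simpa,
        Or.inl ?_⟩⟩
      linarith [(abs_lt.1 hc).2, min_le_right (δ / (2 * (1 + M))) (p - c₀)]
    -- The only place where `(0, p)` must be excluded. With `η = d` and `d * (1 + M) ≤ x₀`, one gets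
    -- `η * M ≤ x₀ - d < x`.
    · have hx₀ : 0 < x₀ := lt_of_le_of_ne hx₀ fun h0 => hne (by rw [← h0, h])
      have hd2 : 0 < x₀ / (1 + M) := by positivity
      refine ⟨min (δ / (2 * (1 + M))) (x₀ / (1 + M)), lt_min hd1 hd2,
        hd1' _ (min_le_left _ _), fun x c hx hxx hc => ?_⟩
      have h1 := hd1' _ (min_le_left (δ / (2 * (1 + M))) (x₀ / (1 + M)))
      have h2 := min_le_right (δ / (2 * (1 + M))) (x₀ / (1 + M))
      have h3 := lt_min hd1 hd2
      set d := min (δ / (2 * (1 + M))) (x₀ / (1 + M))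
      rw [le_div_iff₀ (by positivity)] at h2
      have h4 : 0 ≤ d * M := by positivity
      refine ⟨d, h3.le, by linarith, ?_, Or.inl ?_⟩
      · linarith [(abs_lt.1 hxx).1]
      · linarith [(abs_lt.1 hc).2]
    · refine ⟨min (δ / (2 * (1 + M))) ((c₀ - p) / 2), lt_min hd1 (by linarith),
        hd1' _ (min_le_left _ _), fun x c hx _ hc => ⟨0, le_rfl, by simpa using hδ.le, by simpa,
        Or.inr ?_⟩⟩
      linarith [(abs_lt.1 hc).1, min_le_right (δ / (2 * (1 + M))) ((c₀ - p) / 2), hεc h]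
  refine ⟨d, hd, fun x x' c c' hx hc hc' h1 h2 h3 h4 => ?_⟩
  obtain ⟨η, hη, hηδ, hηx, hgap⟩ := hd2 x c hx h1 h3
  rw [abs_lt] at h1 h2 h3 h4
  have hmax : max (c - c') 0 ≤ 2 * d := max_le (by linarith) (by linarith)
  have hclose : x' - x + max (c - c') 0 * M ≤ δ := by
    have := mul_le_mul_of_nonneg_right hmax hM
    linarith
  have := valueFunction_le_add (cbar := cbar) hm hβ hp hq hF hc hc' hε hδ hη hM hηδ hηx hclose hgap n
  linarith

lemma continuousWithinAt_valueFunction {K : ℝ≥0} (hm : IsCramerLundberg μ β W U) (hβ : 0 < β)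
    (hp : 0 < p) (hq : 0 < q) (hF : LipschitzWith K (claimCDF μ U))
    {z : ℝ × ℝ} (hz : z ∈ valueDomain cbar) (hne : z ≠ ((0 : ℝ), p)) :
    ContinuousWithinAt (fun y : ℝ × ℝ => valueFunction μ p q cbar W U y.1 y.2)
      (valueDomain cbar) z := by
  rw [Metric.continuousWithinAt_iff]
  intro e he
  obtain ⟨d, hd, h⟩ := exists_forall_valueFunction_le_add hm hβ hp hq hF hz.1 hne he
  refine ⟨d, hd, fun y hy hyz => ?_⟩
  rw [Prod.dist_eq, max_lt_iff, Real.dist_eq, Real.dist_eq] at hyz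
  have h0 : ∀ a : ℝ, |a - a| < d := fun a => by simpa
  have h1 := h y.1 z.1 y.2 z.2 hy.1 hy.2 hz.2 hyz.1 (h0 _) hyz.2 (h0 _)
  have h2 := h z.1 y.1 z.2 y.2 hz.1 hz.2 hy.2 (h0 _) hyz.1 (h0 _) hyz.2
  rw [Real.dist_eq, abs_lt]
  constructor <;> linarith

end Shadow

/-! ### Zero initial surplus and the discontinuity -/

lemma lt_ruinTime_const {Ω : Type*} {p : ℝ} {W U : ℕ → Ω → ℝ} {ω : Ω}
    (h : IsRegularPath W U ω) {s : ℝ} (hs : s < arrivalTime W 0 ω) :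
    (s : EReal) < ruinTime p W U 0 (fun _ _ => p) ω := by
  refine lt_of_lt_of_le (EReal.coe_lt_coe_iff.2 hs) (le_iInf₂ fun t ht => ?_)
  by_contra hlt
  have htT : t < arrivalTime W 0 ω := by exact_mod_cast not_le.1 hlt
  have := ht.2
  rw [controlledSurplus, h.freeSurplus_of_lt htT] at this
  simp [mul_comm] at this

section ZeroSurplus

variable {Ω : Type*} [MeasurableSpace Ω] {μ : Measure Ω} {β p q cbar c : ℝ}
  {W U : ℕ → Ω → ℝ} {C : ℝ → Ω → ℝ} {ω : Ω}

/-- Without initial surplus, dividends are paid at most at rate `p` and only before the first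
claim. -/
lemma IsAdmissible.lt_arrivalTime_and_le (hC : IsAdmissible μ p cbar W U 0 c C) (hpc : p ≤ c)
    (h : IsRegularPath W U ω) (hU : 0 < U 0 ω) {s : ℝ} (hs : 0 ≤ s)
    (hsτ : (s : EReal) < ruinTime p W U 0 C ω) : s < arrivalTime W 0 ω ∧ C s ω ≤ p := by
  have hT := h.arrivalTime_pos 0
  have hτ : ruinTime p W U 0 C ω ≤ arrivalTime W 0 ω := by
    refine ruinTime_le hT.le ?_
    have h1 : ∫ _ in (0 : ℝ)..arrivalTime W 0 ω, p ≤ ∫ s in (0 : ℝ)..arrivalTime W 0 ω, C s ω :=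
      intervalIntegral.integral_mono_on hT.le (by simp) (hC.intervalIntegrable ω le_rfl hT.le)
        fun r hr => hpc.trans (hC.mem_Icc ω r hr.1).1
    rw [intervalIntegral.integral_const, smul_eq_mul] at h1
    rw [controlledSurplus, h.freeSurplus_arrivalTime, Finset.sum_range_zero]
    linarith
  refine ⟨by exact_mod_cast hsτ.trans_le hτ, ?_⟩
  by_contra! hCs
  -- The surplus at `s` is at most zero, so a rate above `p` makes it negative immediately
  -- afterwards, at a time `t` still before ruin.
  obtain ⟨t, hst, htτ⟩ := EReal.lt_iff_exists_real_btwn.1 hsτ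
  have hst' : s < t := by exact_mod_cast hst
  have h1 := hC.controlledSurplus_le (p := p) (x := 0) h hs hst'.le le_rfl
  have h2 := hC.controlledSurplus_le (p := p) (x := 0) h le_rfl hs
    (hpc.trans (hC.mem_Icc ω 0 le_rfl).1)
  have h3 := controlledSurplus_nonneg_of_lt_ruinTime (hs.trans hst'.le) htτ
  rw [controlledSurplus_zero h] at h2
  nlinarith

lemma IsAdmissible.discountedPayout_zero_le (hC : IsAdmissible μ p cbar W U 0 c C) (hp : 0 < p)
    (hq : 0 < q) (hpc : p ≤ c) (h : IsRegularPath W U ω) (hU : 0 < U 0 ω) :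
    discountedPayout p q W U 0 C ω ≤ p * ((1 - Real.exp (-q * arrivalTime W 0 ω)) / q) := by
  rw [discountedPayout_eq, ← integral_exp_head hq (h.arrivalTime_pos 0).le, ← integral_const_mul]
  refine setIntegral_mono_on (hC.integrableOn_payout (hp.le.trans hpc) hq ω
    (measurable_coe_real_ereal measurableSet_Iio))
    ((Integrable.indicator (integrableOn_exp_neg hq) measurableSet_Iio).const_mul p)
    measurableSet_Ioi fun s hs => ?_
  have hE := Real.exp_pos (-q * s)
  refine indicator_apply_le' (fun hsτ => ?_) fun _ =>
    mul_nonneg hp.le (indicator_nonneg (fun _ _ => (Real.exp_pos _).le) _)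
  obtain ⟨h1, h2⟩ := hC.lt_arrivalTime_and_le hpc h hU (le_of_lt hs) hsτ
  rw [indicator_of_mem (mem_Iio.2 h1), mul_comm]
  exact mul_le_mul_of_nonneg_right h2 hE.le

/-- Paying exactly the premium income holds the surplus at zero until the first claim, so the upper
bound is attained path by path. -/
lemma discountedPayout_zero_const (μ : Measure Ω) (hp : 0 < p) (hpc : p ≤ cbar)
    (hq : 0 < q) (h : IsRegularPath W U ω) (hU : 0 < U 0 ω) :
    discountedPayout p q W U 0 (fun _ _ => p) ω =
      p * ((1 - Real.exp (-q * arrivalTime W 0 ω)) / q) := by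
  have hC : IsAdmissible μ p cbar W U 0 p fun _ _ => p := isAdmissible_const hpc
  refine le_antisymm (hC.discountedPayout_zero_le hp hq le_rfl h hU) ?_
  rw [discountedPayout_eq, ← integral_exp_head hq (h.arrivalTime_pos 0).le, ← integral_const_mul]
  refine setIntegral_mono_on
    ((Integrable.indicator (integrableOn_exp_neg hq) measurableSet_Iio).const_mul p)
    (hC.integrableOn_payout hp.le hq ω (measurable_coe_real_ereal measurableSet_Iio))
    measurableSet_Ioi fun s hs => ?_
  by_cases hsT : s < arrivalTime W 0 ω
  · rw [indicator_of_mem (mem_Iio.2 hsT), indicator_of_mem, mul_comm]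
    exact lt_ruinTime_const h hsT
  · rw [indicator_of_notMem (by simpa using hsT), mul_zero]
    exact indicator_nonneg (fun _ _ => mul_nonneg (Real.exp_pos _).le hp.le) _

variable [IsProbabilityMeasure μ]

lemma integral_payout_until_arrivalTime (hm : IsCramerLundberg μ β W U) (hβ : 0 < β) (hq : 0 < q) :
    ∫ ω, p * ((1 - Real.exp (-q * arrivalTime W 0 ω)) / q) ∂μ = p / (q + β) := by
  rw [integral_const_mul, integral_div, integral_sub (integrable_const _)
    (hm.integrable_exp_arrivalTime hβ hq 0), hm.integral_exp_arrivalTime hβ hq]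
  simp only [integral_const, probReal_univ, one_smul, zero_add, pow_one]
  have : q + β ≠ 0 := by positivity
  have h : 1 - β / (q + β) = q / (q + β) := by
    rw [eq_div_iff this, sub_mul, div_mul_cancel₀ _ this]
    ring
  rw [h]
  field_simp

lemma valueFunction_zero_premium {K : ℝ≥0} (hm : IsCramerLundberg μ β W U) (hβ : 0 < β)
    (hp : 0 < p) (hq : 0 < q) (hF : LipschitzWith K (claimCDF μ U)) (hpc : p ≤ cbar) :
    valueFunction μ p q cbar W U 0 p = p / (q + β) := by
  rw [← integral_payout_until_arrivalTime (p := p) hm hβ hq]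
  have hgood := (hm.ae_isRegularPath hβ).and (hm.ae_claim_pos hF)
  refine le_antisymm (valueFunction_le_of_forall hpc fun C hC => ?_) ?_
  · refine integral_mono_ae (hC.integrable_discountedPayout hm hβ hp hq hp.le)
      ((((integrable_const _).sub (hm.integrable_exp_arrivalTime hβ hq 0)).div_const q).const_mul p)
      ?_
    filter_upwards [hgood] with ω hω
    exact hC.discountedPayout_zero_le hp hq le_rfl hω.1 hω.2
  · refine le_trans (le_of_eq (integral_congr_ae ?_)) (strategyValue_le_valueFunction hm hβ hp hq
      hp.le (isAdmissible_const (x := 0) hpc))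
    filter_upwards [hgood] with ω hω
    exact (discountedPayout_zero_const μ hp hpc hq hω.1 hω.2).symm

/-- Paying before ruin would require a rate at most `p`, which the constraint `c > p` forbids; the
set of payment times is almost surely empty. -/
lemma valueFunction_zero_of_lt {K : ℝ≥0} (hm : IsCramerLundberg μ β W U) (hβ : 0 < β)
    (hF : LipschitzWith K (claimCDF μ U)) (hc : c ∈ Ioc p cbar) :
    valueFunction μ p q cbar W U 0 c = 0 := by
  have h0 : ∀ C, IsAdmissible μ p cbar W U 0 c C → strategyValue μ p q W U 0 C = 0 := by
    intro C hC
    refine integral_eq_zero_of_ae ?_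
    filter_upwards [hm.ae_isRegularPath hβ, hm.ae_claim_pos hF] with ω h hU
    have : {s : ℝ | 0 ≤ s ∧ (s : EReal) < ruinTime p W U 0 C ω} = ∅ := by
      refine eq_empty_iff_forall_notMem.2 fun s hs => ?_
      have h1 := (hC.lt_arrivalTime_and_le hc.1.le h hU hs.1 hs.2).2
      linarith [hc.1, (hC.mem_Icc ω s hs.1).1]
    simp [this]
  have himage : strategyValue μ p q W U 0 '' {C | IsAdmissible μ p cbar W U 0 c C} = {0} :=
    eq_singleton_iff_nonempty_unique_mem.2
      ⟨Nonempty.image _ ⟨_, isAdmissible_const hc.2⟩, by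
        rintro _ ⟨C, hC, rfl⟩
        exact h0 C hC⟩
  rw [valueFunction, himage, csSup_singleton]

end ZeroSurplus

lemma tendsto_prodMk_nhdsGT_valueDomain {p cbar x : ℝ} (hx : 0 ≤ x) (hp : 0 < p) (hpc : p < cbar) :
    Tendsto (fun c => (x, c)) (𝓝[>] p) (𝓝[valueDomain cbar] (x, p)) := by
  refine tendsto_nhdsWithin_iff.2 ⟨?_, ?_⟩
  · exact (Continuous.prodMk_right x).continuousWithinAt
  · filter_upwards [Ioc_mem_nhdsGT hpc] with c hc
    exact ⟨hx, hp.le.trans hc.1.le, hc.2⟩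

lemma tendsto_of_continuousWithinAt_valueDomain {f : ℝ → ℝ → ℝ} {p cbar x : ℝ} (hx : 0 ≤ x)
    (hp : 0 < p) (hpc : p < cbar)
    (hf : ContinuousWithinAt (fun y : ℝ × ℝ => f y.1 y.2) (valueDomain cbar) (x, p)) :
    Tendsto (fun c => f x c) (𝓝[>] p) (𝓝 (f x p)) :=
  hf.tendsto.comp (tendsto_prodMk_nhdsGT_valueDomain hx hp hpc)

end DividendRatcheting

theorem mainTheorem9 {Ω : Type*} [MeasurableSpace Ω] (μ : Measure Ω) [IsProbabilityMeasure μ]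
    (p q β cbar : ℝ) (W U : ℕ → Ω → ℝ)
    (hq : 0 < q) (hβ : 0 < β)
    (hmodel : DividendRatcheting.IsCramerLundberg μ β W U)
    (hint : Integrable (U 0) μ)
    (hsafety : β * ∫ ω, U 0 ω ∂μ < p)
    (K : ℝ≥0) (hF : LipschitzWith K (DividendRatcheting.claimCDF μ U))
    (hcbar : p < cbar) :
    (∀ x : ℝ, 0 < x →
      Tendsto (fun c => DividendRatcheting.valueFunction μ p q cbar W U x c) (𝓝[>] p)
        (𝓝 (DividendRatcheting.valueFunction μ p q cbar W U x p))) ∧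
    (∀ z ∈ DividendRatcheting.valueDomain cbar, z ≠ ((0 : ℝ), p) →
      ContinuousWithinAt
        (fun y : ℝ × ℝ => DividendRatcheting.valueFunction μ p q cbar W U y.1 y.2)
        (DividendRatcheting.valueDomain cbar) z) ∧
    ¬ ContinuousWithinAt
        (fun y : ℝ × ℝ => DividendRatcheting.valueFunction μ p q cbar W U y.1 y.2)
        (DividendRatcheting.valueDomain cbar) ((0 : ℝ), p) ∧
    DividendRatcheting.valueFunction μ p q cbar W U 0 p = p / (q + β) ∧
    (∀ c ∈ Ioc p cbar, DividendRatcheting.valueFunction μ p q cbar W U 0 c = 0) ∧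
    Tendsto (fun c => DividendRatcheting.valueFunction μ p q cbar W U 0 c) (𝓝[>] p) (𝓝 0) := by
  -- Safety loading and nonnegative claims force a positive premium rate.
  have hp : 0 < p := lt_of_le_of_lt
    (mul_nonneg hβ.le (integral_nonneg_of_ae (hmodel.claim_nonneg 0))) hsafety
  have hcont := fun z hz hne => DividendRatcheting.continuousWithinAt_valueFunction (z := z)
    (cbar := cbar) hmodel hβ hp hq hF hz hne
  have hval := DividendRatcheting.valueFunction_zero_premium hmodel hβ hp hq hF hcbar.le
  have hzero := fun c hc => DividendRatcheting.valueFunction_zero_of_lt (c := c) (q := q) hmodel hβ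
    hF (p := p) (cbar := cbar) hc
  have hlim : Tendsto (fun c => DividendRatcheting.valueFunction μ p q cbar W U 0 c) (𝓝[>] p)
      (𝓝 0) := by
    refine tendsto_const_nhds.congr' ?_
    filter_upwards [Ioc_mem_nhdsGT hcbar] with c hc
    exact (hzero c hc).symm
  refine ⟨fun x hx => ?_, hcont, fun hc => ?_, hval, hzero, hlim⟩
  · exact DividendRatcheting.tendsto_of_continuousWithinAt_valueDomain hx.le hp hcbar
      (hcont (x, p) ⟨hx.le, hp.le, hcbar.le⟩ fun h => hx.ne' (Prod.ext_iff.1 h).1)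
  · have h := DividendRatcheting.tendsto_of_continuousWithinAt_valueDomain le_rfl hp hcbar hc
    have hpos : 0 < p / (q + β) := by positivity
    rw [hval] at h
    exact hpos.ne' (tendsto_nhds_unique h hlim)
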